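/- Let $Z$ be a planar piecewise polynomial system with separation line $y=0$, $$Z^\pm:\quad \dot x=-y+\sum_{k=2}^{n}P_k^\pm(x,y),\qquad \dot y=x+\sum_{k=2}^{n}Q_k^\pm(x,y),\qquad\text{if } \pm y>0,$$ where $P_k^\pm,Q_k^\pm$ are real homogeneous polynomials of degree $k$. A (local) twin transformation is a pair $\Psi^+,\Psi^-$ of homeomorphisms between neighbourhoods of the origin of $\mathbb R^2$ with $\Psi^\pm(0,0)=(0,0)$, such that $\Psi^+$ preserves the side $y>0$, $\Psi^-$ preserves the side $y<0$, and $\Psi^+(x,0)=\Psi^-(x,0)$ wherever both are defined. It transforms $Z$ into a piecewise system $W=(W^+,W^-)$ with separation line $y=0$ if, for each sign, $\Psi^\pm$ is differentiable with invertible derivative at the points of its domain $D^\pm$ with $\pm y>0$, and $W^\pm(\Psi^\pm(p))=c^\pm(p)\,D\Psi^\pm(p)Z^\pm(p)$ there, for some positive continuous function $c^\pm$ on $D^\pm\cap\{\pm y>0\}$ (a rescaling of time; $c^\pm=1$ is allowed). Suppose that some twin transformation (possibly the identity) transforms $Z$ into a system $W$ that satisfies one of the following conditions near the origin: (a) $W^\pm$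 have first integrals $H^\pm$ with $H^+(x,0)=H^-(x,0)$; here a first integral of $W^\pm$ is a function that is continuous on $\{\pm y\ge 0\}$ near the origin, constant along the solutions of $W^\pm$ in $\{\pm y>0\}$ near the origin, and not constant on $V\cap\{\pm y>0\}$ for any neighbourhood $V$ of the origin; (b) $W$ is invariant under $(x,y,t)\to(x,-y,-t)$, that is, $W^-(x,y)=\bigl(-W^+_1(x,-y),\,W^+_2(x,-y)\bigr)$ for $y<0$; (c) $W^+$ and $W^-$ are both invariant under $(x,y,t)\to(-x,y,-t)$, that is, $W^\pm(x,y)=\bigl(W_1^\pm(-x,y),\,-W_2^\pm(-x,y)\bigr)$ for $\pm y>0$. Then $Z$ has a center at the origin: there is a neighbourhood $U$ of the origin such that through every point of $U\setminus\{(0,0)\}$ there passes a periodic orbit of $Z$, contained in $U$, which is a simple closed curve that meets the line $y=0$ only at crossing points (where the second components of $Z^+$ and $Z^-$ are nonzero and of the same sign), exactly once per period with $x>0$ and exactly once per period with $x<0$. -/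

import Mathlib

open Set Filter Topology

/-- A planar piecewise vector field with separation line `y = 0`: the field `upper` is in force
where `y > 0` and the field `lower` is in force where `y < 0`. -/
structure PiecewiseField where
  upper : ℝ × ℝ → ℝ × ℝ
  lower : ℝ × ℝ → ℝ × ℝ

/-- The open upper half-plane. -/
def upperSide : Set (ℝ × ℝ) := {p | 0 < p.2}

/-- The open lower half-plane. -/
def lowerSide : Set (ℝ × ℝ) := {p | p.2 < 0}

/-- The polynomial vector field `(-y + ∑_{k=2}^n P_k, x + ∑_{k=2}^n Q_k)`, with `P_k`, `Q_k`
homogeneous of degree `k`. -/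
def IsCanonicalField (F : ℝ × ℝ → ℝ × ℝ) : Prop :=
  ∃ (n : ℕ) (P Q : ℕ → MvPolynomial (Fin 2) ℝ),
    (∀ k, (P k).IsHomogeneous k) ∧ (∀ k, (Q k).IsHomogeneous k) ∧
    ∀ x y : ℝ, F (x, y) =
      (-y + ∑ k ∈ Finset.Icc 2 n, MvPolynomial.eval ![x, y] (P k),
        x + ∑ k ∈ Finset.Icc 2 n, MvPolynomial.eval ![x, y] (Q k))

/-- Both half-systems have the canonical form above. -/
def PiecewiseField.IsCanonical (Z : PiecewiseField) : Prop :=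
  IsCanonicalField Z.upper ∧ IsCanonicalField Z.lower

/-- A global solution of the piecewise system that meets `y = 0` only at crossing points (points
where the second components of both fields are nonzero and of the same sign). At such a point it
arrives with the velocity of the side that it leaves and departs with that of the side that it
enters. -/
structure PiecewiseField.IsCrossingSolution (Z : PiecewiseField) (γ : ℝ → ℝ × ℝ) : Prop where
  on_upper : ∀ t, 0 < (γ t).2 → HasDerivAt γ (Z.upper (γ t)) t
  on_lower : ∀ t, (γ t).2 < 0 → HasDerivAt γ (Z.lower (γ t)) t
  on_line : ∀ t, (γ t).2 = 0 →
    (0 < (Z.upper (γ t)).2 ∧ 0 < (Z.lower (γ t)).2 ∧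
      HasDerivWithinAt γ (Z.lower (γ t)) (Iic t) t ∧
      HasDerivWithinAt γ (Z.upper (γ t)) (Ici t) t) ∨
    ((Z.upper (γ t)).2 < 0 ∧ (Z.lower (γ t)).2 < 0 ∧
      HasDerivWithinAt γ (Z.upper (γ t)) (Iic t) t ∧
      HasDerivWithinAt γ (Z.lower (γ t)) (Ici t) t)

/-- A crossing periodic orbit of period `T` around the origin: a simple closed curve that crosses
each of the two half-axes of `y = 0` exactly once per period. -/
structure PiecewiseField.IsCrossingPeriodicOrbit (Z : PiecewiseField) (γ : ℝ → ℝ × ℝ) (T : ℝ) :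
    Prop where
  solution : Z.IsCrossingSolution γ
  period_pos : 0 < T
  periodic : Function.Periodic γ T
  simple : InjOn γ (Ico 0 T)
  cross_pos : ∃! t, t ∈ Ico 0 T ∧ (γ t).2 = 0 ∧ 0 < (γ t).1
  cross_neg : ∃! t, t ∈ Ico 0 T ∧ (γ t).2 = 0 ∧ (γ t).1 < 0

/-- The origin is a center: some neighbourhood of it consists of the origin and of crossing
periodic orbits around the origin. -/
def PiecewiseField.IsCenter (Z : PiecewiseField) : Prop :=
  ∃ U ∈ 𝓝 (0 : ℝ × ℝ), ∀ p ∈ U, p ≠ 0 →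
    ∃ (γ : ℝ → ℝ × ℝ) (T : ℝ), Z.IsCrossingPeriodicOrbit γ T ∧ γ 0 = p ∧ ∀ t, γ t ∈ U

/-- `H` is, near the origin, a first integral of the field `F` on the side `S`: it is continuous up
to the boundary of `S`, constant along the solutions in `S`, and not constant near the origin. -/
def IsFirstIntegralNear (F : ℝ × ℝ → ℝ × ℝ) (S : Set (ℝ × ℝ)) (H : ℝ × ℝ → ℝ) : Prop :=
  (∃ U ∈ 𝓝 (0 : ℝ × ℝ), ContinuousOn H (U ∩ closure S) ∧
    ∀ (γ : ℝ → ℝ × ℝ) (a b : ℝ),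
      (∀ t ∈ Ioo a b, γ t ∈ U ∩ S ∧ HasDerivAt γ (F (γ t)) t) →
      ∀ s ∈ Ioo a b, ∀ t ∈ Ioo a b, H (γ s) = H (γ t)) ∧
  ∀ V ∈ 𝓝 (0 : ℝ × ℝ), ∃ p ∈ V ∩ S, ∃ q ∈ V ∩ S, H p ≠ H q

/-- The two sides have first integrals near the origin that agree on `y = 0`. -/
def PiecewiseField.HasMatchingFirstIntegrals (W : PiecewiseField) : Prop :=
  ∃ H₁ H₂ : ℝ × ℝ → ℝ, IsFirstIntegralNear W.upper upperSide H₁ ∧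
    IsFirstIntegralNear W.lower lowerSide H₂ ∧ ∀ᶠ x in 𝓝 (0 : ℝ), H₁ (x, 0) = H₂ (x, 0)

/-- Near the origin, the piecewise system is invariant under `(x, y, t) ↦ (x, -y, -t)`, which
interchanges the two sides. -/
def PiecewiseField.IsReversibleAcross (W : PiecewiseField) : Prop :=
  ∀ᶠ p : ℝ × ℝ in 𝓝 0, p.2 < 0 →
    W.lower p = (-(W.upper (p.1, -p.2)).1, (W.upper (p.1, -p.2)).2)

/-- Near the origin, each of the two half-systems is invariant under
`(x, y, t) ↦ (-x, y, -t)`. -/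
def PiecewiseField.IsReversibleOnSides (W : PiecewiseField) : Prop :=
  ∀ᶠ p : ℝ × ℝ in 𝓝 0,
    (0 < p.2 → W.upper p = ((W.upper (-p.1, p.2)).1, -(W.upper (-p.1, p.2)).2)) ∧
    (p.2 < 0 → W.lower p = ((W.lower (-p.1, p.2)).1, -(W.lower (-p.1, p.2)).2))

/-- A (local) twin transformation for the line `y = 0`: two homeomorphisms between neighbourhoods
of the origin that fix the origin, preserve the respective sides (hence the line), and agree on the
line. -/
structure TwinTransformation where
  upper : OpenPartialHomeomorph (ℝ × ℝ) (ℝ × ℝ)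
  lower : OpenPartialHomeomorph (ℝ × ℝ) (ℝ × ℝ)
  zero_mem_upper : (0 : ℝ × ℝ) ∈ upper.source
  zero_mem_lower : (0 : ℝ × ℝ) ∈ lower.source
  upper_zero : upper 0 = 0
  lower_zero : lower 0 = 0
  upper_side : ∀ p ∈ upper.source, upper p ∈ upperSide ↔ p ∈ upperSide
  lower_side : ∀ p ∈ lower.source, lower p ∈ lowerSide ↔ p ∈ lowerSide
  agree : ∀ x : ℝ, (x, 0) ∈ upper.source → (x, 0) ∈ lower.source → upper (x, 0) = lower (x, 0)

/-- The change of variables `ψ` transforms, on the side `S`, the field `F` into the field `G`, up to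
a positive continuous rescaling `c` of time (`c = 1` is the transformation without rescaling). -/
def TransformsField (ψ : OpenPartialHomeomorph (ℝ × ℝ) (ℝ × ℝ)) (S : Set (ℝ × ℝ))
    (F G : ℝ × ℝ → ℝ × ℝ) : Prop :=
  ∃ c : ℝ × ℝ → ℝ, ContinuousOn c (ψ.source ∩ S) ∧ ∀ p ∈ ψ.source ∩ S, 0 < c p ∧
    ∃ L : (ℝ × ℝ) ≃L[ℝ] (ℝ × ℝ), HasFDerivAt ψ (L : (ℝ × ℝ) →L[ℝ] (ℝ × ℝ)) p ∧
      G (ψ p) = c p • L (F p)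

/-- The twin transformation `Ψ` transforms the piecewise system `Z` into `W`. -/
def TwinTransformation.Transforms (Ψ : TwinTransformation) (Z W : PiecewiseField) : Prop :=
  TransformsField Ψ.upper upperSide Z.upper W.upper ∧
    TransformsField Ψ.lower lowerSide Z.lower W.lower

/-- The identity is a twin transformation. -/
def TwinTransformation.refl : TwinTransformation where
  upper := OpenPartialHomeomorph.refl _
  lower := OpenPartialHomeomorph.refl _
  zero_mem_upper := mem_univ _
  zero_mem_lower := mem_univ _
  upper_zero := rfl
  lower_zero := rfl
  upper_side := fun _ _ => Iff.rfl
  lower_side := fun _ _ => Iff.rfl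
  agree := fun _ _ _ => rfl

/-- The identity transforms every piecewise system into itself, so that a statement about all twin
transformations contains the case in which none is applied. -/
theorem TwinTransformation.refl_transforms (Z : PiecewiseField) :
    TwinTransformation.refl.Transforms Z Z := by
  constructor <;>
  · refine ⟨fun _ => 1, continuousOn_const, fun p _ => ⟨one_pos, ContinuousLinearEquiv.refl ℝ _, ?_⟩⟩
    exact ⟨hasFDerivAt_id p, by simp [TwinTransformation.refl]⟩

/-!
Near the origin the orbits of `Z` turn around it, so that `Z` has a center if and only if the
half-return map `ρ⁺` of the upper side, which sends `(x, 0)` to `(-ρ⁺ x, 0)`, and the half-return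
map `ρ⁻` of the lower side, which sends `(-x, 0)` to `(ρ⁻ x, 0)`, satisfy `ρ⁻ (ρ⁺ x) = x` for small
`x > 0`. The lower side is reduced to the upper one by the rotation `p ↦ -p`.

In polar coordinates an orbit on a side is a solution of a scalar equation `dr/dθ = R(θ, r)` on
`[0, π]`, with `R` of order `r²`. It is the solution of an analytic equation in the Banach algebra
`C([0, π], ℝ)`, hence an analytic function of its initial value (`exists_analytic_scalar_flow`,
`IsCanonicalField.nonempty_polarFlow`); in particular the half-return maps are analytic at `0`. The
initial value of the orbit through a point is a continuous first integral on the closed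
half-disc, and it is constant along every curve with velocity parallel to the field
(`PolarFlow.label_eq_of_curve`). Hence a map that carries orbits to orbits, up to any change of time
and its direction, carries the ends of half-orbits to the ends of half-orbits
(`PolarFlow.eventually_label_eq`).

If `ρ⁻ ∘ ρ⁺` is the identity, two half-orbits join to a closed curve, and the integral of
`dt/dθ`, which jumps at the line, is the time of the periodic orbit
(`PolarFlow.isCenter_of_ret_ret`).

If `W` is reversible, the composition of the twin transformation, the symmetry, and the inverse of
the twin transformation carries orbits to orbits. For the symmetry across the line, it takes
half-orbits of the upper side to half-orbits of the lower side with the same ends. For the symmetry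
`x ↦ -x`, it takes half-orbits to half-orbits of the same side, so that in the coordinate of the
line given by `Ψ` the decreasing involution that exchanges the two ends commutes with `x ↦ -x`; such an
involution is `x ↦ -x` itself, on both sides (`PolarFlow.eventually_apply_ret_of_reversible`). If
`W` has matching first integrals, pulled back to the line they give one continuous function that is
invariant under `ρ⁻ ∘ ρ⁺`. If the analytic map `ρ⁻ ∘ ρ⁺` is not the identity, then it has no other
fixed points near `0`, and the function is constant (`eventually_fixed_or_invariant_const`); as all
half-orbits end on the line, so is the first integral, which is excluded.
-/

/-! ### Analytic dependence of a scalar equation on the initial value -/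

/-- If `N` is analytic and vanishes to second order at `0`, then the equation `v = x + N v` has an
analytic solution `v = Φ x` near `0`: the local inverse of `id - N`. -/
theorem exists_analytic_fixedPoint {E : Type*} [NormedAddCommGroup E] [NormedSpace ℝ E]
    [CompleteSpace E] {N : E → E} (hN : AnalyticAt ℝ N 0) (h0 : N 0 = 0)
    (hd : HasFDerivAt N (0 : E →L[ℝ] E) 0) :
    ∃ Φ : E → E, AnalyticAt ℝ Φ 0 ∧ Φ 0 = 0 ∧
      HasStrictFDerivAt Φ (ContinuousLinearMap.id ℝ E) 0 ∧ ∀ᶠ x in 𝓝 0, Φ x = x + N (Φ x) := by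
  set F : E → E := fun x => x - N x with hF
  have hF0 : F 0 = 0 := by simp [hF, h0]
  have hFa : AnalyticAt ℝ F 0 := analyticAt_id.sub hN
  have hFd : HasFDerivAt F ((ContinuousLinearEquiv.refl ℝ E : E ≃L[ℝ] E) : E →L[ℝ] E) 0 := by
    have := (hasFDerivAt_id (𝕜 := ℝ) (0 : E)).sub hd
    rw [sub_zero] at this
    exact this
  have hFc : ContDiffAt ℝ (⊤ : WithTop ℕ∞) F 0 := hFa.contDiffAt
  have htop : (⊤ : WithTop ℕ∞) ≠ 0 := by simp
  have hs := hFc.hasStrictFDerivAt' hFd htop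
  refine ⟨hFc.localInverse hFd htop, ?_, ?_, ?_, ?_⟩
  · have := hFc.to_localInverse hFd htop
    rw [hF0] at this
    exact this.analyticAt
  · have := hFc.localInverse_apply_image hFd htop
    rwa [hF0] at this
  · have := hs.to_localInverse
    rw [hF0] at this
    exact this
  · have := hs.eventually_right_inverse
    rw [hF0] at this
    filter_upwards [this] with x hx
    have hx' : hFc.localInverse hFd htop x - N (hFc.localInverse hFd htop x) = x := hx
    exact (sub_eq_iff_eq_add.1 hx')

/-- The integration operator `g ↦ (θ ↦ ∫₀^θ g)` on continuous functions on `[0, L]`. -/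
noncomputable def primitiveCLM {L : ℝ} (hL : 0 ≤ L) : C(Icc 0 L, ℝ) →L[ℝ] C(Icc 0 L, ℝ) :=
  LinearMap.mkContinuous
    { toFun := fun g =>
        ⟨fun θ => ∫ s in (0 : ℝ)..θ, IccExtend hL g s,
          (intervalIntegral.continuous_primitive
            (fun _ _ => (g.continuous.Icc_extend').intervalIntegrable _ _) 0).comp
            continuous_subtype_val⟩
      map_add' := fun f g => by
        ext θ
        simp only [ContinuousMap.coe_mk, ContinuousMap.add_apply]
        rw [← intervalIntegral.integral_add
          ((f.continuous.Icc_extend').intervalIntegrable _ _)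
          ((g.continuous.Icc_extend').intervalIntegrable _ _)]
        rfl
      map_smul' := fun c g => by
        ext θ
        simp only [ContinuousMap.coe_mk, ContinuousMap.smul_apply, RingHom.id_apply]
        rw [← intervalIntegral.integral_smul]
        rfl } L fun g => by
    refine (ContinuousMap.norm_le _ (by positivity)).2 fun θ => ?_
    have := intervalIntegral.norm_integral_le_of_norm_le_const (a := 0) (b := (θ : ℝ))
      (f := IccExtend hL g) (C := ‖g‖) fun s _ => g.norm_coe_le_norm _
    refine this.trans ?_
    rw [sub_zero, abs_of_nonneg θ.2.1, mul_comm]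
    exact mul_le_mul_of_nonneg_right θ.2.2 (norm_nonneg _)

theorem primitiveCLM_apply {L : ℝ} (hL : 0 ≤ L) (g : C(Icc 0 L, ℝ)) (θ : Icc 0 L) :
    primitiveCLM hL g θ = ∫ s in (0 : ℝ)..θ, IccExtend hL g s := rfl

/-- The solution of `dv/dθ = v² a(θ, v) / (1 + v b(θ, v))`, `v(0) = ρ`, on `[0, L]` exists for
small `ρ`, and it is an analytic function of `ρ` with values in the Banach algebra `C([0, L], ℝ)`:
in that algebra the right-hand side is an analytic expression in `v`, and its primitive is a
continuous linear function of it, so that `exists_analytic_fixedPoint` applies to the integral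
equation. The coefficients are `a = ∑ vᵏ aₖ(θ)` and `b = ∑ vᵏ bₖ(θ)`. The bound says that
`ρ ↦ Φ ρ θ` is close to the identity, uniformly in `θ`. -/
theorem exists_analytic_scalar_flow {L : ℝ} (hL : 0 ≤ L) (n : ℕ) (a b : ℕ → C(Icc 0 L, ℝ)) :
    ∃ Φ : ℝ → C(Icc 0 L, ℝ), AnalyticAt ℝ Φ 0 ∧ Φ 0 = 0 ∧
      ∃ δ > 0, (∀ ρ, |ρ| < δ → ∀ ρ', |ρ'| < δ → ∀ θ,
          |Φ ρ θ - Φ ρ' θ - (ρ - ρ')| ≤ 1 / 2 * |ρ - ρ'|) ∧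
        ∀ ρ, |ρ| < δ → ∀ θ : Icc 0 L, Φ ρ θ = ρ + ∫ s in (0 : ℝ)..θ,
          IccExtend hL (fun t => Φ ρ t ^ 2 * (∑ k ∈ Finset.range n, Φ ρ t ^ k * a k t) /
            (1 + Φ ρ t * ∑ k ∈ Finset.range n, Φ ρ t ^ k * b k t)) s := by
  set S : (ℕ → C(Icc 0 L, ℝ)) → C(Icc 0 L, ℝ) → C(Icc 0 L, ℝ) := fun a v =>
    ∑ k ∈ Finset.range n, v ^ k * a k with hS
  have hSa : ∀ a, AnalyticAt ℝ (S a) 0 := fun a =>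
    Finset.analyticAt_fun_sum _ fun k _ => (analyticAt_id.pow k).mul analyticAt_const
  set q : C(Icc 0 L, ℝ) → C(Icc 0 L, ℝ) := fun v => S a v * Ring.inverse (1 + v * S b v) with hq
  have hqa : AnalyticAt ℝ q 0 := by
    refine (hSa a).mul (AnalyticAt.fun_comp ?_ (analyticAt_const.add (analyticAt_id.mul (hSa b))))
    simpa using analyticAt_inverse (𝕜 := ℝ) (1 : C(Icc 0 L, ℝ)ˣ)
  set G : C(Icc 0 L, ℝ) → C(Icc 0 L, ℝ) := fun v => v * (v * q v) with hG
  have hGa : AnalyticAt ℝ G 0 := analyticAt_id.mul (analyticAt_id.mul hqa)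
  have hGd : HasFDerivAt G (0 : C(Icc 0 L, ℝ) →L[ℝ] C(Icc 0 L, ℝ)) 0 := by
    have h1 := (hasFDerivAt_id (𝕜 := ℝ) (0 : C(Icc 0 L, ℝ))).mul'
      ((analyticAt_id.mul hqa).differentiableAt (x := (0 : C(Icc 0 L, ℝ)))).hasFDerivAt
    refine h1.congr_fderiv ?_
    ext v
    simp
  obtain ⟨Φ, hΦa, hΦ0, hΦd, hΦe⟩ := exists_analytic_fixedPoint
    (N := fun v => primitiveCLM hL (G v))
    (((primitiveCLM hL).analyticAt _).fun_comp hGa) (by simp [hG])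
    (by simpa using! (primitiveCLM hL).hasFDerivAt.comp (0 : C(Icc 0 L, ℝ)) hGd)
  set ι : ℝ →L[ℝ] C(Icc 0 L, ℝ) :=
    (ContinuousLinearMap.id ℝ ℝ).smulRight (1 : C(Icc 0 L, ℝ)) with hι
  have hι0 : ι 0 = 0 := map_zero _
  have hιt : Tendsto ι (𝓝 0) (𝓝 0) := by simpa using ι.continuous.tendsto 0
  have hιn : ∀ x θ, ι x θ = x := fun x θ => by simp [hι]
  have hunit : ∀ᶠ v in 𝓝 (0 : C(Icc 0 L, ℝ)), IsUnit (1 + v * S b v) := by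
    have hc : ContinuousAt (fun v : C(Icc 0 L, ℝ) => 1 + v * S b v) 0 :=
      (analyticAt_const.add (analyticAt_id.mul (hSa b))).continuousAt
    refine hc.eventually ?_
    simpa using! Units.isOpen.mem_nhds (isUnit_one : IsUnit (1 : C(Icc 0 L, ℝ)))
  have hΦt : Tendsto Φ (𝓝 0) (𝓝 0) := by
    simpa [hΦ0] using hΦa.continuousAt.tendsto
  have hlip : ∀ᶠ p : C(Icc 0 L, ℝ) × C(Icc 0 L, ℝ) in 𝓝 0,
      ‖Φ p.1 - Φ p.2 - (p.1 - p.2)‖ ≤ 1 / 2 * ‖p.1 - p.2‖ := by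
    have := hΦd.isLittleO.def (c := 1 / 2) (by norm_num)
    rw [← Prod.mk_zero_zero]
    simpa using this
  have hlip' : ∀ᶠ p : ℝ × ℝ in 𝓝 0,
      ‖Φ (ι p.1) - Φ (ι p.2) - (ι p.1 - ι p.2)‖ ≤ 1 / 2 * ‖ι p.1 - ι p.2‖ := by
    have ht : Tendsto (Prod.map ι ι) (𝓝 (0 : ℝ × ℝ)) (𝓝 (0 : C(Icc 0 L, ℝ) × C(Icc 0 L, ℝ))) := by
      have := hιt.prodMap hιt
      rwa [← nhds_prod_eq, ← nhds_prod_eq] at this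
    exact ht.eventually hlip
  have hall := hlip'.and ((hιt.eventually (hΦe.and (hΦt.eventually hunit))).prod_inl_nhds
    (0 : ℝ))
  obtain ⟨δ, hδ, hδ'⟩ := Metric.eventually_nhds_iff.1 hall
  refine ⟨fun ρ => Φ (ι ρ), ?_, by simp [hι0, hΦ0], δ, hδ, ?_, ?_⟩
  · exact AnalyticAt.fun_comp (by rwa [hι0]) (ι.analyticAt 0)
  · intro ρ hρ ρ' hρ' θ
    have h1 := (hδ' (y := (ρ, ρ')) (by simpa [Prod.dist_eq] using ⟨hρ, hρ'⟩)).1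
    have h2 := (ContinuousMap.norm_coe_le_norm _ θ).trans h1
    have h3 : ‖ι ρ - ι ρ'‖ ≤ |ρ - ρ'| :=
      (ContinuousMap.norm_le _ (abs_nonneg _)).2 fun x => by simp [hιn]
    simp only [ContinuousMap.sub_apply, hιn, Real.norm_eq_abs] at h2
    exact h2.trans (by gcongr)
  · intro ρ hρ θ
    obtain ⟨h1, h2⟩ := (hδ' (y := (ρ, 0)) (by simpa [Prod.dist_eq, hδ] using hρ)).2
    dsimp only at h1 h2
    set v := Φ (ι ρ)
    have h3 := congrArg (fun f : C(Icc 0 L, ℝ) => f θ) h1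
    simp only [ContinuousMap.add_apply, hιn, primitiveCLM_apply] at h3
    rw [h3]
    refine congrArg (ρ + ·) (intervalIntegral.integral_congr fun s _ =>
      congrArg (fun h => IccExtend hL h s) (funext fun t => ?_))
    have h4 := congrArg (fun f : C(Icc 0 L, ℝ) => f t) (Ring.mul_inverse_cancel _ h2)
    have hSt : ∀ a, S a v t = ∑ k ∈ Finset.range n, v t ^ k * a k t := fun a => by
      simp [hS, ContinuousMap.sum_apply]
    simp only [ContinuousMap.mul_apply, ContinuousMap.add_apply, ContinuousMap.one_apply,
      hSt] at h4
    simp only [hG, hq, ContinuousMap.mul_apply, hSt]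
    rw [eq_div_iff (left_ne_zero_of_mul_eq_one h4)]
    linear_combination (v t ^ 2 * ∑ k ∈ Finset.range n, v t ^ k * a k t) * h4

/-! ### The field in polar coordinates -/

theorem MvPolynomial.IsHomogeneous.eval_mul_mul {P : MvPolynomial (Fin 2) ℝ} {k : ℕ}
    (hP : P.IsHomogeneous k) (r x y : ℝ) :
    MvPolynomial.eval ![r * x, r * y] P = r ^ k * MvPolynomial.eval ![x, y] P := by
  rw [MvPolynomial.eval_eq', MvPolynomial.eval_eq', Finset.mul_sum]
  refine Finset.sum_congr rfl fun d hd => ?_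
  have hk : d 0 + d 1 = k := by
    have := hP (MvPolynomial.mem_support_iff.1 hd)
    rw [← this]
    simp [Finsupp.weight_apply, Finsupp.sum_fintype]
  simp only [Fin.prod_univ_two, Matrix.cons_val_zero, Matrix.cons_val_one, mul_pow, ← hk, pow_add]
  ring

/-- The radial component of a canonical field is `r² ∑ rᵏ Aₖ(θ)` and the angular one is
`r (1 + r ∑ rᵏ Bₖ(θ))`. -/
theorem IsCanonicalField.exists_polar_form {F : ℝ × ℝ → ℝ × ℝ} (hF : IsCanonicalField F) :
    ∃ (n : ℕ) (A B : ℕ → C(ℝ, ℝ)), ∀ r θ : ℝ,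
      F (r * Real.cos θ, r * Real.sin θ) =
        (r ^ 2 * (∑ k ∈ Finset.range n, r ^ k * A k θ) * Real.cos θ -
            r * (1 + r * ∑ k ∈ Finset.range n, r ^ k * B k θ) * Real.sin θ,
          r ^ 2 * (∑ k ∈ Finset.range n, r ^ k * A k θ) * Real.sin θ +
            r * (1 + r * ∑ k ∈ Finset.range n, r ^ k * B k θ) * Real.cos θ) := by
  obtain ⟨n, P, Q, hP, hQ, hF⟩ := hF
  have hc : ∀ R : MvPolynomial (Fin 2) ℝ,
      Continuous fun θ : ℝ => MvPolynomial.eval ![Real.cos θ, Real.sin θ] R := fun R => by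
    refine (MvPolynomial.continuous_eval R).comp (continuous_pi fun i => ?_)
    fin_cases i
    · exact Real.continuous_cos
    · exact Real.continuous_sin
  set p : ℕ → ℝ → ℝ := fun k θ => MvPolynomial.eval ![Real.cos θ, Real.sin θ] (P (2 + k)) with hp
  set q : ℕ → ℝ → ℝ := fun k θ => MvPolynomial.eval ![Real.cos θ, Real.sin θ] (Q (2 + k)) with hq
  refine ⟨n + 1 - 2,
    fun k => ⟨fun θ => p k θ * Real.cos θ + q k θ * Real.sin θ,
      ((hc _).mul Real.continuous_cos).add ((hc _).mul Real.continuous_sin)⟩,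
    fun k => ⟨fun θ => q k θ * Real.cos θ - p k θ * Real.sin θ,
      ((hc _).mul Real.continuous_cos).sub ((hc _).mul Real.continuous_sin)⟩, fun r θ => ?_⟩
  have hI : Finset.Icc 2 n = Finset.Ico 2 (n + 1) := by
    ext; simp only [Finset.mem_Icc, Finset.mem_Ico]; omega
  have hs : ∀ R : ℕ → MvPolynomial (Fin 2) ℝ, (∀ k, (R k).IsHomogeneous k) →
      ∑ k ∈ Finset.Icc 2 n, MvPolynomial.eval ![r * Real.cos θ, r * Real.sin θ] (R k) =
      r ^ 2 * ∑ k ∈ Finset.range (n + 1 - 2),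
        r ^ k * MvPolynomial.eval ![Real.cos θ, Real.sin θ] (R (2 + k)) := fun R hR => by
    rw [hI, Finset.sum_Ico_eq_sum_range, Finset.mul_sum]
    refine Finset.sum_congr rfl fun k _ => ?_
    rw [(hR _).eval_mul_mul, pow_add]
    ring
  have hA : ∑ k ∈ Finset.range (n + 1 - 2), r ^ k * (p k θ * Real.cos θ + q k θ * Real.sin θ) =
      (∑ k ∈ Finset.range (n + 1 - 2), r ^ k * p k θ) * Real.cos θ +
        (∑ k ∈ Finset.range (n + 1 - 2), r ^ k * q k θ) * Real.sin θ := by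
    rw [Finset.sum_mul, Finset.sum_mul, ← Finset.sum_add_distrib]
    exact Finset.sum_congr rfl fun k _ => by ring
  have hB : ∑ k ∈ Finset.range (n + 1 - 2), r ^ k * (q k θ * Real.cos θ - p k θ * Real.sin θ) =
      (∑ k ∈ Finset.range (n + 1 - 2), r ^ k * q k θ) * Real.cos θ -
        (∑ k ∈ Finset.range (n + 1 - 2), r ^ k * p k θ) * Real.sin θ := by
    rw [Finset.sum_mul, Finset.sum_mul, ← Finset.sum_sub_distrib]
    exact Finset.sum_congr rfl fun k _ => by ring
  rw [hF, hs P hP, hs Q hQ]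
  simp only [ContinuousMap.coe_mk]
  rw [hA, hB]
  change (_ + r ^ 2 * (∑ k ∈ Finset.range (n + 1 - 2), r ^ k * p k θ),
    _ + r ^ 2 * (∑ k ∈ Finset.range (n + 1 - 2), r ^ k * q k θ)) = _
  have hcs := Real.sin_sq_add_cos_sq θ
  ext
  · dsimp only
    linear_combination (-r ^ 2 * (∑ k ∈ Finset.range (n + 1 - 2), r ^ k * p k θ)) * hcs
  · dsimp only
    linear_combination (-r ^ 2 * (∑ k ∈ Finset.range (n + 1 - 2), r ^ k * q k θ)) * hcs

/-- The flow of a planar field `F` across the closed upper half-plane near the origin, with the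
polar angle as time. In polar coordinates `F` is `speed θ r` times
`rate θ r ∂/∂r + ∂/∂θ`, and `radial ρ` is the solution of `dr/dθ = rate θ r` on `[0, π]` with
`r = ρ` at `θ = 0`. Negative `ρ` are included so that the half-return map `radial · π` is
analytic in a full neighbourhood of `0`. -/
structure PolarFlow (F : ℝ × ℝ → ℝ × ℝ) where
  radius : ℝ
  radius_pos : 0 < radius
  rate : ℝ → ℝ → ℝ
  speed : ℝ → ℝ → ℝ
  radial : ℝ → ℝ → ℝ
  speed_cont : Continuous (Function.uncurry speed)
  speed_pos : ∀ θ ∈ Icc 0 Real.pi, ∀ r, |r| < 2 * radius → 0 < speed θ r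
  polar : ∀ θ ∈ Icc 0 Real.pi, ∀ r, |r| < 2 * radius →
    F (r * Real.cos θ, r * Real.sin θ) = speed θ r •
      (rate θ r * Real.cos θ - r * Real.sin θ, rate θ r * Real.sin θ + r * Real.cos θ)
  radial_start : ∀ ρ, |ρ| < radius → radial ρ 0 = ρ
  radial_zero : ∀ θ, radial 0 θ = 0
  radial_deriv : ∀ ρ, |ρ| < radius → ∀ θ ∈ Icc 0 Real.pi,
    HasDerivWithinAt (radial ρ) (rate θ (radial ρ θ)) (Icc 0 Real.pi) θ
  radial_close : ∀ ρ, |ρ| < radius → ∀ ρ', |ρ'| < radius → ∀ θ,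
    |radial ρ θ - radial ρ' θ - (ρ - ρ')| ≤ 1 / 2 * |ρ - ρ'|
  analytic_return : AnalyticAt ℝ (fun ρ => radial ρ Real.pi) 0

theorem IsCanonicalField.nonempty_polarFlow {F : ℝ × ℝ → ℝ × ℝ} (hF : IsCanonicalField F) :
    Nonempty (PolarFlow F) := by
  obtain ⟨n, A, B, hF⟩ := hF.exists_polar_form
  have hπ := Real.pi_pos.le
  obtain ⟨Φ, hΦa, hΦ0, δ₁, hδ₁, hclose, hint⟩ := exists_analytic_scalar_flow hπ n
    (fun k => (A k).restrict (Icc 0 Real.pi)) (fun k => (B k).restrict (Icc 0 Real.pi))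
  set α : ℝ → ℝ → ℝ := fun θ r => ∑ k ∈ Finset.range n, r ^ k * A k θ with hα
  set ω : ℝ → ℝ → ℝ := fun θ r => 1 + r * ∑ k ∈ Finset.range n, r ^ k * B k θ with hω
  have hαc : Continuous fun p : ℝ × ℝ => α p.1 p.2 := by fun_prop
  have hωc : Continuous fun p : ℝ × ℝ => ω p.1 p.2 := by fun_prop
  have hωpos : ∀ᶠ r : ℝ in 𝓝 0, ∀ θ ∈ Icc 0 Real.pi, 0 < ω θ r := by
    refine isCompact_Icc.eventually_forall_of_forall_eventually fun θ _ => ?_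
    have : Tendsto (fun z : ℝ × ℝ => ω z.2 z.1) (𝓝 (0, θ)) (𝓝 1) := by
      have h := (hωc.comp continuous_swap).tendsto (0, θ)
      simpa [hω, Function.comp_def] using h
    exact this.eventually (lt_mem_nhds one_pos)
  obtain ⟨δ₂, hδ₂, hω'⟩ := Metric.eventually_nhds_iff.1 hωpos
  have hclose' : ∀ ρ, |ρ| < min δ₁ (δ₂ / 2) → ∀ θ, |Φ ρ θ| < δ₂ := fun ρ hρ θ => by
    have h := hclose ρ (hρ.trans_le (min_le_left _ _)) 0 (by simpa using hδ₁) θ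
    simp only [hΦ0, ContinuousMap.zero_apply, sub_zero] at h
    have h1 := abs_sub_abs_le_abs_sub (Φ ρ θ) ρ
    have h2 := hρ.trans_le (min_le_right _ _)
    have := abs_nonneg ρ
    linarith
  refine ⟨⟨min δ₁ (δ₂ / 2), lt_min hδ₁ (by linarith), fun θ r => r ^ 2 * α θ r / ω θ r, ω,
    fun ρ => IccExtend hπ (Φ ρ), hωc, ?_, ?_, ?_, ?_, ?_, ?_, ?_⟩⟩
  · intro θ hθ r hr
    refine hω' (y := r) ?_ θ hθ
    rw [dist_zero_right, Real.norm_eq_abs]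
    exact hr.trans_le (by linarith [min_le_right δ₁ (δ₂ / 2)])
  · intro θ hθ r hr
    have h0 : 0 < ω θ r := by
      refine hω' (y := r) ?_ θ hθ
      rw [dist_zero_right, Real.norm_eq_abs]
      exact hr.trans_le (by linarith [min_le_right δ₁ (δ₂ / 2)])
    rw [hF]
    change (r ^ 2 * α θ r * _ - r * ω θ r * _, r ^ 2 * α θ r * _ + r * ω θ r * _) = _
    ext
    · simp only [Prod.smul_mk, smul_eq_mul]
      field_simp
    · simp only [Prod.smul_mk, smul_eq_mul]
      field_simp
  · intro ρ hρ
    rw [IccExtend_of_mem hπ _ (left_mem_Icc.2 hπ), hint ρ (hρ.trans_le (min_le_left _ _))]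
    simp
  · intro θ
    simp [IccExtend, hΦ0]
  · intro ρ hρ θ hθ
    have hρ1 := hρ.trans_le (min_le_left _ _)
    set g : Icc 0 Real.pi → ℝ := fun t => Φ ρ t ^ 2 * α t (Φ ρ t) / ω t (Φ ρ t) with hg
    have hgc : Continuous g := by
      have hpair : Continuous fun t : Icc 0 Real.pi => ((t : ℝ), Φ ρ t) := by fun_prop
      refine (((Φ ρ).continuous.pow 2).mul (hαc.comp hpair)).div (hωc.comp hpair) fun t => ?_
      exact (hω' (y := Φ ρ t) (by simpa using hclose' ρ hρ t) t t.2).ne'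
    have hgθ : IccExtend hπ g θ =
        IccExtend hπ (Φ ρ) θ ^ 2 * α θ (IccExtend hπ (Φ ρ) θ) / ω θ (IccExtend hπ (Φ ρ) θ) := by
      rw [IccExtend_of_mem hπ _ hθ, IccExtend_of_mem hπ _ hθ]
    rw [← hgθ]
    have hd : HasDerivAt (fun x => ρ + ∫ s in (0 : ℝ)..x, IccExtend hπ g s)
        (IccExtend hπ g θ) θ :=
      ((hgc.Icc_extend' (h := hπ)).integral_hasStrictDerivAt 0 θ).hasDerivAt.const_add ρ
    refine hd.hasDerivWithinAt.congr (fun x hx => ?_) ?_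
    · rw [IccExtend_of_mem hπ _ hx, hint ρ hρ1 ⟨x, hx⟩]
      rfl
    · rw [IccExtend_of_mem hπ _ hθ, hint ρ hρ1 ⟨θ, hθ⟩]
      rfl
  · intro ρ hρ ρ' hρ' θ
    exact hclose ρ (hρ.trans_le (min_le_left _ _)) ρ' (hρ'.trans_le (min_le_left _ _)) _
  · set π' : Icc 0 Real.pi := projIcc 0 Real.pi hπ Real.pi
    exact ((ContinuousMap.evalCLM ℝ π').analyticAt (Φ 0)).fun_comp hΦa

/-! ### Arcs on one side of the line -/

/-- The Euclidean distance to the origin; the norm of `ℝ × ℝ` is the maximum norm. -/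
noncomputable def polarRadius (p : ℝ × ℝ) : ℝ := √(p.1 ^ 2 + p.2 ^ 2)

/-- The polar angle in `[0, π]` of a point of the closed upper half-plane. -/
noncomputable def polarAngle (p : ℝ × ℝ) : ℝ := Real.arccos (p.1 / polarRadius p)

theorem continuous_polarRadius : Continuous polarRadius := by
  unfold polarRadius; fun_prop

theorem polarRadius_zero : polarRadius 0 = 0 := by simp [polarRadius]

theorem polarRadius_sq (p : ℝ × ℝ) : polarRadius p ^ 2 = p.1 ^ 2 + p.2 ^ 2 :=
  Real.sq_sqrt (by positivity)

theorem polarRadius_pos {p : ℝ × ℝ} (hp : p ≠ 0) : 0 < polarRadius p := by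
  refine Real.sqrt_pos.2 ?_
  by_contra! h
  apply hp
  have h1 : p.1 = 0 := by nlinarith [sq_nonneg p.1, sq_nonneg p.2]
  have h2 : p.2 = 0 := by nlinarith [sq_nonneg p.1, sq_nonneg p.2]
  exact Prod.ext h1 h2

theorem polarRadius_polar {r : ℝ} (hr : 0 ≤ r) (θ : ℝ) :
    polarRadius (r * Real.cos θ, r * Real.sin θ) = r := by
  rw [polarRadius, Real.sqrt_eq_iff_mul_self_eq (by positivity) hr]
  linear_combination r ^ 2 * Real.sin_sq_add_cos_sq θ

theorem polarAngle_polar {r θ : ℝ} (hr : 0 < r) (hθ : θ ∈ Icc 0 Real.pi) :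
    polarAngle (r * Real.cos θ, r * Real.sin θ) = θ := by
  rw [polarAngle, polarRadius_polar hr.le, mul_div_cancel_left₀ _ hr.ne',
    Real.arccos_cos hθ.1 hθ.2]

theorem polarAngle_mem (p : ℝ × ℝ) : polarAngle p ∈ Icc 0 Real.pi :=
  ⟨Real.arccos_nonneg _, Real.arccos_le_pi _⟩

theorem abs_fst_le_polarRadius (p : ℝ × ℝ) : |p.1| ≤ polarRadius p :=
  Real.abs_le_sqrt (by nlinarith [sq_nonneg p.2])

theorem polar_fst {p : ℝ × ℝ} (hp : p ≠ 0) :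
    polarRadius p * Real.cos (polarAngle p) = p.1 := by
  have h0 := polarRadius_pos hp
  have h1 := abs_le.1 (abs_fst_le_polarRadius p)
  rw [polarAngle, Real.cos_arccos, mul_div_cancel₀ _ h0.ne']
  · rw [le_div_iff₀ h0]; linarith
  · rw [div_le_iff₀ h0]; linarith

theorem polar_snd {p : ℝ × ℝ} (hp : p ≠ 0) (hy : 0 ≤ p.2) :
    polarRadius p * Real.sin (polarAngle p) = p.2 := by
  have h0 := polarRadius_pos hp
  rw [polarAngle, Real.sin_arccos, ← sq_eq_sq₀ (by positivity) hy, mul_pow, Real.sq_sqrt]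
  · field_simp
    linear_combination polarRadius_sq p
  · rw [sub_nonneg, div_pow, div_le_one (by positivity), polarRadius_sq]
    nlinarith [sq_nonneg p.2]

theorem polar_eta {p : ℝ × ℝ} (hp : p ≠ 0) (hy : 0 ≤ p.2) :
    (polarRadius p * Real.cos (polarAngle p), polarRadius p * Real.sin (polarAngle p)) = p :=
  Prod.ext (polar_fst hp) (polar_snd hp hy)

theorem HasDerivAt.polarRadius {η : ℝ → ℝ × ℝ} {v : ℝ × ℝ} {t : ℝ} (h : HasDerivAt η v t)
    (h0 : η t ≠ 0) :
    HasDerivAt (fun s => polarRadius (η s))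
      (((η t).1 * v.1 + (η t).2 * v.2) / polarRadius (η t)) t := by
  have hp := polarRadius_pos h0
  have h1 : HasDerivAt (fun s => (η s).1) v.1 t := h.fst
  have h2 : HasDerivAt (fun s => (η s).2) v.2 t := h.snd
  have h3 := ((h1.fun_pow 2).fun_add (h2.fun_pow 2)).sqrt (by
    rw [← polarRadius_sq]; positivity)
  refine h3.congr_deriv ?_
  change _ / (2 * _root_.polarRadius (η t)) = _
  field_simp
  simp only [Nat.cast_ofNat]
  ring

theorem HasDerivAt.polarAngle {η : ℝ → ℝ × ℝ} {v : ℝ × ℝ} {t : ℝ} (h : HasDerivAt η v t)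
    (hy : 0 < (η t).2) :
    HasDerivAt (fun s => polarAngle (η s))
      (((η t).1 * v.2 - (η t).2 * v.1) / _root_.polarRadius (η t) ^ 2) t := by
  have h0 : η t ≠ 0 := fun h => by simp [h] at hy
  have hp := polarRadius_pos h0
  have hsq := polarRadius_sq (η t)
  have h1 : HasDerivAt (fun s => (η s).1) v.1 t := h.fst
  have h2 := h1.fun_div (h.polarRadius h0) hp.ne'
  have hlt : |(η t).1| < _root_.polarRadius (η t) := by
    apply abs_lt_of_sq_lt_sq _ hp.le
    rw [hsq]
    nlinarith
  obtain ⟨hl, hr⟩ := abs_lt.1 hlt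
  have hs : √(1 - ((η t).1 / _root_.polarRadius (η t)) ^ 2) =
      (η t).2 / _root_.polarRadius (η t) := by
    rw [Real.sqrt_eq_iff_eq_sq _ (by positivity), div_pow, div_pow]
    · field_simp
      linear_combination hsq
    · rw [sub_nonneg, div_pow, div_le_one (by positivity), hsq]
      nlinarith
  have h3 := (Real.hasDerivAt_arccos (x := (η t).1 / _root_.polarRadius (η t))
    (by rw [Ne, div_eq_iff hp.ne']; linarith) (by rw [Ne, div_eq_iff hp.ne']; linarith)).comp t h2
  refine h3.congr_deriv ?_
  rw [hs]
  field_simp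
  linear_combination (-v.1) * hsq

theorem ContinuousWithinAt.polarAngle {η : ℝ → ℝ × ℝ} {s : Set ℝ} {t : ℝ}
    (h : ContinuousWithinAt η s t) (h0 : η t ≠ 0) :
    ContinuousWithinAt (fun x => polarAngle (η x)) s t :=
  Real.continuous_arccos.continuousAt.comp_continuousWithinAt
    (h.fst.div (continuous_polarRadius.continuousAt.comp_continuousWithinAt h)
      (polarRadius_pos h0).ne')

namespace PolarFlow

variable {F : ℝ × ℝ → ℝ × ℝ} (f : PolarFlow F)

theorem abs_radial_le {ρ : ℝ} (hρ : |ρ| < f.radius) (θ : ℝ) :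
    |f.radial ρ θ| ≤ 3 / 2 * |ρ| := by
  have h := f.radial_close ρ hρ 0 (by simpa using f.radius_pos) θ
  rw [f.radial_zero, sub_zero, sub_zero] at h
  linarith [abs_sub_abs_le_abs_sub (f.radial ρ θ) ρ]

theorem abs_radial_lt {ρ : ℝ} (hρ : |ρ| < f.radius) (θ : ℝ) :
    |f.radial ρ θ| < 2 * f.radius := by
  linarith [f.abs_radial_le hρ θ, abs_nonneg ρ]

theorem half_le_radial {ρ : ℝ} (h0 : 0 < ρ) (hρ : ρ < f.radius) (θ : ℝ) :
    ρ / 2 ≤ f.radial ρ θ := by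
  have h := f.radial_close ρ (by rwa [abs_of_pos h0]) 0 (by simpa using f.radius_pos) θ
  rw [f.radial_zero, sub_zero, sub_zero, abs_of_pos h0] at h
  linarith [(abs_le.1 h).1]

theorem radial_pos {ρ : ℝ} (h0 : 0 < ρ) (hρ : ρ < f.radius) (θ : ℝ) : 0 < f.radial ρ θ := by
  linarith [f.half_le_radial h0 hρ θ]

theorem radial_le {ρ : ℝ} (h0 : 0 < ρ) (hρ : ρ < f.radius) (θ : ℝ) :
    f.radial ρ θ ≤ 3 / 2 * ρ := by
  have h := f.abs_radial_le (by rwa [abs_of_pos h0]) θ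
  rw [abs_of_pos h0] at h
  exact (le_abs_self _).trans h

theorem abs_sub_le_radial {ρ ρ' : ℝ} (hρ : |ρ| < f.radius) (hρ' : |ρ'| < f.radius) (θ : ℝ) :
    |ρ - ρ'| ≤ 2 * |f.radial ρ θ - f.radial ρ' θ| := by
  have h := f.radial_close ρ hρ ρ' hρ' θ
  rw [abs_sub_comm] at h
  linarith [abs_sub_abs_le_abs_sub (ρ - ρ') (f.radial ρ θ - f.radial ρ' θ)]

theorem radial_strictMono (θ : ℝ) :
    StrictMonoOn (fun ρ => f.radial ρ θ) (Ioo (-f.radius) f.radius) := fun ρ hρ ρ' hρ' hlt => by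
  have h := f.radial_close ρ' (abs_lt.2 hρ') ρ (abs_lt.2 hρ) θ
  rw [abs_of_pos (sub_pos.2 hlt)] at h
  have := (abs_le.1 h).1
  dsimp only
  linarith

theorem radial_continuousOn (θ : ℝ) :
    ContinuousOn (fun ρ => f.radial ρ θ) (Ioo (-f.radius) f.radius) := by
  refine LipschitzOnWith.continuousOn (K := 2)
    (LipschitzOnWith.of_dist_le_mul fun ρ hρ ρ' hρ' => ?_)
  have h := f.radial_close ρ (abs_lt.2 hρ) ρ' (abs_lt.2 hρ') θ
  rw [Real.dist_eq, Real.dist_eq]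
  have := abs_sub_abs_le_abs_sub (f.radial ρ θ - f.radial ρ' θ) (ρ - ρ')
  have := abs_nonneg (ρ - ρ')
  simp only [NNReal.coe_ofNat]
  linarith

theorem exists_radial_eq {r : ℝ} (h0 : 0 < r) (hr : 2 * r < f.radius) (θ : ℝ) :
    ∃ ρ, (0 < ρ ∧ ρ ≤ 2 * r) ∧ f.radial ρ θ = r := by
  have hsub : Icc 0 (2 * r) ⊆ Ioo (-f.radius) f.radius := fun x hx =>
    ⟨by linarith [hx.1, f.radius_pos], by linarith [hx.2]⟩
  obtain ⟨ρ, hρ, h⟩ := intermediate_value_Icc (by linarith : (0 : ℝ) ≤ 2 * r)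
    ((f.radial_continuousOn θ).mono hsub)
    (show r ∈ Icc (f.radial 0 θ) (f.radial (2 * r) θ) from
      ⟨by rw [f.radial_zero]; exact h0.le, by
        linarith [f.half_le_radial (by linarith : 0 < 2 * r) hr θ]⟩)
  refine ⟨ρ, ⟨lt_of_le_of_ne hρ.1 ?_, hρ.2⟩, h⟩
  rintro rfl
  dsimp only at h
  rw [f.radial_zero] at h
  exact h0.ne h

/-- The arc of orbit of `F` that starts at `(ρ, 0)`, parametrized by the polar angle. -/
noncomputable def arc (ρ θ : ℝ) : ℝ × ℝ :=
  (f.radial ρ θ * Real.cos θ, f.radial ρ θ * Real.sin θ)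

/-- The half-return map: the orbit through `(ρ, 0)` next meets the line at `(-ret ρ, 0)`. -/
noncomputable def ret (ρ : ℝ) : ℝ := f.radial ρ Real.pi

theorem arc_zero {ρ : ℝ} (hρ : |ρ| < f.radius) : f.arc ρ 0 = (ρ, 0) := by
  simp [arc, f.radial_start ρ hρ]

theorem arc_pi (ρ : ℝ) : f.arc ρ Real.pi = (-f.ret ρ, 0) := by simp [arc, ret]

theorem hasDerivWithinAt_arc {ρ θ : ℝ} (hρ : |ρ| < f.radius) (hθ : θ ∈ Icc 0 Real.pi) :
    HasDerivWithinAt (f.arc ρ) ((f.speed θ (f.radial ρ θ))⁻¹ • F (f.arc ρ θ))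
      (Icc 0 Real.pi) θ := by
  have hr := f.radial_deriv ρ hρ θ hθ
  have h := (hr.fun_mul (Real.hasDerivAt_cos θ).hasDerivWithinAt).prodMk
    (hr.fun_mul (Real.hasDerivAt_sin θ).hasDerivWithinAt)
  refine h.congr_deriv ?_
  have hb := f.abs_radial_lt hρ θ
  rw [arc, f.polar θ hθ _ hb, inv_smul_smul₀ (f.speed_pos θ hθ _ hb).ne']
  ext <;> simp
  ring

theorem hasDerivAt_arc {ρ θ : ℝ} (hρ : |ρ| < f.radius) (hθ : θ ∈ Ioo 0 Real.pi) :
    HasDerivAt (f.arc ρ) ((f.speed θ (f.radial ρ θ))⁻¹ • F (f.arc ρ θ)) θ :=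
  (f.hasDerivWithinAt_arc hρ (Ioo_subset_Icc_self hθ)).hasDerivAt (Icc_mem_nhds hθ.1 hθ.2)

theorem continuousOn_radial {ρ : ℝ} (hρ : |ρ| < f.radius) :
    ContinuousOn (f.radial ρ) (Icc 0 Real.pi) :=
  fun θ hθ => (f.radial_deriv ρ hρ θ hθ).continuousWithinAt

theorem continuousOn_arc {ρ : ℝ} (hρ : |ρ| < f.radius) :
    ContinuousOn (f.arc ρ) (Icc 0 Real.pi) :=
  fun _ hθ => (f.hasDerivWithinAt_arc hρ hθ).continuousWithinAt

theorem continuousOn_speed {ρ : ℝ} (hρ : |ρ| < f.radius) :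
    ContinuousOn (fun θ => f.speed θ (f.radial ρ θ)) (Icc 0 Real.pi) :=
  f.speed_cont.comp_continuousOn (continuousOn_id.prodMk (f.continuousOn_radial hρ))

theorem speed_radial_pos {ρ : ℝ} (hρ : |ρ| < f.radius) {θ : ℝ} (hθ : θ ∈ Icc 0 Real.pi) :
    0 < f.speed θ (f.radial ρ θ) :=
  f.speed_pos θ hθ _ (f.abs_radial_lt hρ θ)

theorem arc_snd_pos {ρ : ℝ} (h0 : 0 < ρ) (hρ : ρ < f.radius) {θ : ℝ} (hθ : θ ∈ Ioo 0 Real.pi) :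
    0 < (f.arc ρ θ).2 :=
  mul_pos (f.radial_pos h0 hρ θ) (Real.sin_pos_of_mem_Ioo hθ)

theorem arc_ne_zero {ρ : ℝ} (h0 : 0 < ρ) (hρ : ρ < f.radius) (θ : ℝ) : f.arc ρ θ ≠ 0 := by
  intro h
  have h1 := polarRadius_polar (f.radial_pos h0 hρ θ).le θ
  change polarRadius (f.arc ρ θ) = _ at h1
  rw [h, polarRadius_zero] at h1
  exact (f.radial_pos h0 hρ θ).ne h1

/-- The initial value `ρ` of the arc through `p`: a continuous first integral of `F` on the
closed upper half-plane near the origin. Where no arc passes, the value is arbitrary. -/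
noncomputable def label (p : ℝ × ℝ) : ℝ :=
  Classical.epsilon fun ρ =>
    (0 < ρ ∧ ρ < f.radius) ∧ f.radial ρ (polarAngle p) = polarRadius p

theorem label_spec {p : ℝ × ℝ} (h0 : p ≠ 0) (hp : 2 * polarRadius p < f.radius) :
    (0 < f.label p ∧ f.label p < f.radius) ∧
      f.radial (f.label p) (polarAngle p) = polarRadius p :=
  Classical.epsilon_spec (p := fun ρ =>
    (0 < ρ ∧ ρ < f.radius) ∧ f.radial ρ (polarAngle p) = polarRadius p) <| by
  obtain ⟨ρ, ⟨h1, h2⟩, h3⟩ := f.exists_radial_eq (polarRadius_pos h0) hp (polarAngle p)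
  exact ⟨ρ, ⟨h1, h2.trans_lt hp⟩, h3⟩

theorem label_arc {ρ θ : ℝ} (h0 : 0 < ρ) (hρ : ρ < f.radius) (hθ : θ ∈ Icc 0 Real.pi) :
    f.label (f.arc ρ θ) = ρ := by
  have h1 : polarAngle (f.arc ρ θ) = θ := polarAngle_polar (f.radial_pos h0 hρ θ) hθ
  have h2 : polarRadius (f.arc ρ θ) = f.radial ρ θ :=
    polarRadius_polar (f.radial_pos h0 hρ θ).le θ
  have h := Classical.epsilon_spec (p := fun ρ' =>
    (0 < ρ' ∧ ρ' < f.radius) ∧ f.radial ρ' (polarAngle (f.arc ρ θ)) = polarRadius (f.arc ρ θ))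
    ⟨ρ, ⟨h0, hρ⟩, by rw [h1, h2]⟩
  change (0 < f.label _ ∧ f.label _ < _) ∧ f.radial (f.label _) _ = _ at h
  rw [h1, h2] at h
  exact (f.radial_strictMono θ).injOn ⟨by linarith [h.1.1], h.1.2⟩ ⟨by linarith, hρ⟩ h.2

theorem arc_label {p : ℝ × ℝ} (h0 : p ≠ 0) (hy : 0 ≤ p.2) (hp : 2 * polarRadius p < f.radius) :
    f.arc (f.label p) (polarAngle p) = p := by
  rw [arc, (f.label_spec h0 hp).2, polar_eta h0 hy]

theorem label_le {p : ℝ × ℝ} (h0 : p ≠ 0) (hp : 2 * polarRadius p < f.radius) :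
    f.label p ≤ 2 * polarRadius p := by
  obtain ⟨⟨h1, h2⟩, h3⟩ := f.label_spec h0 hp
  linarith [f.half_le_radial h1 h2 (polarAngle p)]

/-- `label` is constant along every curve whose velocity is a multiple of `F`. The multiple is
arbitrary, so that no reparametrization of the curve is needed. -/
theorem label_eq_of_curve {η : ℝ → ℝ × ℝ} {a b : ℝ} (hab : a < b) (hc : ContinuousOn η (Icc a b))
    (h0 : ∀ t ∈ Icc a b, η t ≠ 0)
    (hr : ∀ t ∈ Icc a b, 2 * polarRadius (η t) < f.radius)
    (hd : ∀ t ∈ Ioo a b, 0 < (η t).2 ∧ ∃ k : ℝ, HasDerivAt η (k • F (η t)) t) :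
    f.label (η a) = f.label (η b) := by
  set ρ : ℝ → ℝ := fun t => f.label (η t) with hρ
  have hlab : ∀ t ∈ Icc a b, |ρ t| < f.radius := fun t ht => by
    have := (f.label_spec (h0 t ht) (hr t ht)).1
    rw [abs_of_pos this.1]
    exact this.2
  have hkey : ∀ t ∈ Icc a b, ∀ s ∈ Icc a b, |ρ s - ρ t| ≤
      2 * |polarRadius (η s) - f.radial (ρ t) (polarAngle (η s))| := fun t ht s hs => by
    have := f.abs_sub_le_radial (hlab s hs) (hlab t ht) (polarAngle (η s))
    rwa [(f.label_spec (h0 s hs) (hr s hs)).2] at this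
  have hcont : ContinuousOn ρ (Icc a b) := fun t ht => by
    have h1 : ContinuousWithinAt
        (fun s => polarRadius (η s) - f.radial (ρ t) (polarAngle (η s))) (Icc a b) t := by
      refine (continuous_polarRadius.continuousAt.comp_continuousWithinAt (hc t ht)).sub ?_
      exact ContinuousWithinAt.comp (g := f.radial (ρ t)) (f := fun s => polarAngle (η s))
        (f.continuousOn_radial (hlab t ht) _ (polarAngle_mem _))
        ((hc t ht).polarAngle (h0 t ht)) fun s _ => polarAngle_mem _
    have h2 : Tendsto (fun s => 2 * |polarRadius (η s) - f.radial (ρ t) (polarAngle (η s))|)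
        (𝓝[Icc a b] t) (𝓝 0) := by
      have := (h1.tendsto.abs).const_mul 2
      rwa [(f.label_spec (h0 t ht) (hr t ht)).2, sub_self, abs_zero, mul_zero] at this
    refine tendsto_iff_dist_tendsto_zero.2 (squeeze_zero' (.of_forall fun _ => dist_nonneg) ?_ h2)
    filter_upwards [self_mem_nhdsWithin] with s hs
    exact hkey t ht s hs
  have hder : ∀ t ∈ Ioo a b, HasDerivAt ρ 0 t := fun t ht => by
    have ht' := Ioo_subset_Icc_self ht
    obtain ⟨hy, k, hk⟩ := hd t ht
    obtain ⟨⟨hl0, hl⟩, hrad⟩ := f.label_spec (h0 t ht') (hr t ht')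
    have hpos := polarRadius_pos (h0 t ht')
    have hθ : polarAngle (η t) ∈ Ioo 0 Real.pi := by
      have hs := polar_snd (h0 t ht') hy.le
      have hs' : Real.sin (polarAngle (η t)) ≠ 0 := fun h => by
        rw [h, mul_zero] at hs
        exact hy.ne hs
      refine ⟨lt_of_le_of_ne (polarAngle_mem _).1 fun h => hs' ?_,
        lt_of_le_of_ne (polarAngle_mem _).2 fun h => hs' ?_⟩
      · rw [← h, Real.sin_zero]
      · rw [h, Real.sin_pi]
    have h1 := ((f.radial_deriv (ρ t) (hlab t ht') _ (polarAngle_mem (η t))).hasDerivAt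
      (Icc_mem_nhds hθ.1 hθ.2)).comp t (hk.polarAngle hy)
    have h2 := (hk.polarRadius (h0 t ht')).fun_sub h1
    have hF := f.polar (polarAngle (η t)) (polarAngle_mem _) (polarRadius (η t))
      (by rw [abs_of_pos hpos]; linarith [hr t ht', f.radius_pos])
    rw [polar_eta (h0 t ht') hy.le] at hF
    -- the curve is tangent to the arc through `η t`, so that its distance to that arc has
    -- derivative zero; by `hkey` the change of the label is at most twice this distance
    have hD : HasDerivAt (fun s => polarRadius (η s) - f.radial (ρ t) (polarAngle (η s))) 0 t := by
      refine h2.congr_deriv ?_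
      have hx := polar_fst (h0 t ht')
      have hy' := polar_snd (h0 t ht') hy.le
      rw [show f.radial (ρ t) (polarAngle (η t)) = polarRadius (η t) from hrad, hF, ← hx, ← hy']
      simp only [Prod.smul_mk, smul_eq_mul]
      set c := Real.cos (polarAngle (η t))
      set s := Real.sin (polarAngle (η t))
      field_simp
      ring
    have hO : (fun s => ρ s - ρ t) =O[𝓝 t]
        fun s => polarRadius (η s) - f.radial (ρ t) (polarAngle (η s)) := by
      refine Asymptotics.IsBigO.of_bound 2 ?_
      filter_upwards [Icc_mem_nhds ht.1 ht.2] with s hs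
      exact hkey t ht' s hs
    have ho := hasDerivAt_iff_isLittleO.1 hD
    rw [hasDerivAt_iff_isLittleO]
    simp only [smul_zero, sub_zero] at ho ⊢
    refine hO.trans_isLittleO ?_
    simpa [show f.radial (ρ t) (polarAngle (η t)) = polarRadius (η t) from hrad] using ho
  obtain ⟨c, hc1, hc2⟩ := exists_hasDerivAt_eq_slope ρ (fun _ => 0) hab hcont hder
  rw [eq_comm, div_eq_zero_iff] at hc2
  rcases hc2 with h | h <;> [exact (sub_eq_zero.1 h).symm; linarith]

end PolarFlow

/-! ### Change of time, rotation, and closed loops -/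

/-- A primitive of `κ` as an order isomorphism of `ℝ`; `κ` may have jumps. -/
theorem exists_orderIso_of_integral {κ : ℝ → ℝ} {m : ℝ} (hm : 0 < m) (hκ : ∀ t, m ≤ κ t)
    (hi : ∀ a b, IntervalIntegrable κ MeasureTheory.volume a b) :
    ∃ e : ℝ ≃o ℝ, ∀ a b, e b - e a = ∫ t in a..b, κ t := by
  set E : ℝ → ℝ := fun x => ∫ t in (0 : ℝ)..x, κ t with hE
  have hsub : ∀ a b, E b - E a = ∫ t in a..b, κ t := fun a b =>
    intervalIntegral.integral_interval_sub_left (hi _ _) (hi _ _)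
  have hlow : ∀ a b, a ≤ b → m * (b - a) ≤ E b - E a := fun a b hab => by
    rw [hsub]
    have := intervalIntegral.integral_mono_on hab
      (intervalIntegrable_const (c := m)) (hi a b) fun x _ => hκ x
    simpa [mul_comm] using this
  have hmono : StrictMono E := fun a b hab => by
    have := hlow a b hab.le
    nlinarith [mul_pos hm (sub_pos.2 hab)]
  have hcont : Continuous E := intervalIntegral.continuous_primitive hi 0
  have hE0 : E 0 = 0 := by simp [hE]
  have htop : Tendsto E atTop atTop := by
    refine tendsto_atTop_mono' _ ?_ (tendsto_id.const_mul_atTop hm)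
    filter_upwards [eventually_ge_atTop 0] with x hx
    have := hlow 0 x hx
    simp only [id]
    linarith
  have hbot : Tendsto E atBot atBot := by
    refine tendsto_atBot_mono' _ ?_ (tendsto_id.const_mul_atBot hm)
    filter_upwards [eventually_le_atBot 0] with x hx
    have := hlow x 0 hx
    simp only [id]
    linarith
  exact ⟨hmono.orderIsoOfSurjective E (hcont.surjective htop hbot), hsub⟩

theorem OrderIso.hasDerivWithinAt_symm (e : ℝ ≃o ℝ) {d x : ℝ} {s : Set ℝ} (hx : x ∈ s)
    (h : HasDerivWithinAt e d s x) (hd : d ≠ 0) :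
    HasDerivWithinAt e.symm d⁻¹ (e '' s) (e x) := by
  have hm : MapsTo e.symm (e '' s) s := by
    rintro _ ⟨y, hy, rfl⟩
    simpa using hy
  have ht : Tendsto e.symm (𝓝[e '' s] (e x)) (𝓝[s] (e.symm (e x))) :=
    e.symm.continuous.continuousAt.continuousWithinAt.tendsto_nhdsWithin hm
  have hf : HasFDerivWithinAt e
      ((ContinuousLinearEquiv.unitsEquivAut ℝ (Units.mk0 d hd) : ℝ ≃L[ℝ] ℝ) : ℝ →L[ℝ] ℝ) s
      (e.symm (e x)) := by
    rw [e.symm_apply_apply]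
    refine h.hasFDerivWithinAt.congr_fderiv ?_
    ext
    simp
  refine (hf.of_local_left_inverse ht (mem_image_of_mem e hx)
    (.of_forall fun y => e.apply_symm_apply y)).hasDerivWithinAt.congr_deriv ?_
  simp

/-- One-sided derivatives of a primitive of `κ` at the ends of an interval inside which `κ` agrees
with a function `k` that is continuous up to the ends. -/
theorem hasDerivWithinAt_timeChange {e : ℝ ≃o ℝ} {κ k : ℝ → ℝ} {a b : ℝ} (hab : a ≤ b)
    (he : ∀ a b, e b - e a = ∫ t in a..b, κ t) (hk : ContinuousOn k (Icc a b))
    (hκ : EqOn κ k (Ioo a b)) {θ : ℝ} (hθ : θ ∈ Icc a b) :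
    HasDerivWithinAt e (k θ) (Icc a b) θ := by
  have hc : Continuous (IccExtend hab ((Icc a b).domRestrict k)) :=
    hk.domRestrict.Icc_extend'
  have hd : HasDerivAt (fun x => e a + ∫ s in a..x, IccExtend hab ((Icc a b).domRestrict k) s)
      (IccExtend hab ((Icc a b).domRestrict k) θ) θ :=
    (hc.integral_hasStrictDerivAt a θ).hasDerivAt.const_add _
  rw [IccExtend_of_mem hab _ hθ] at hd
  have hx : ∀ x ∈ Icc a b, e x = e a + ∫ s in a..x, IccExtend hab ((Icc a b).domRestrict k) s := by
    intro x hx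
    rw [← intervalIntegral.integral_congr_Ioo_of_le (f := κ) hx.1, ← he]
    · ring
    · intro s hs
      have hs' : s ∈ Ioo a b := ⟨hs.1, hs.2.trans_le hx.2⟩
      rw [IccExtend_of_mem hab _ (Ioo_subset_Icc_self hs')]
      exact hκ hs'
  exact hd.hasDerivWithinAt.congr hx (hx θ hθ)

/-- A curve that moves along `G` with speed factor `k`, after the change of time `e` with
derivative `k`, is a solution of `G`. -/
theorem hasDerivWithinAt_comp_symm {e : ℝ ≃o ℝ} {κ k : ℝ → ℝ} {a b : ℝ} (hab : a ≤ b)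
    (he : ∀ a b, e b - e a = ∫ t in a..b, κ t) (hk : ContinuousOn k (Icc a b))
    (hκ : EqOn κ k (Ioo a b)) (hpos : ∀ θ ∈ Icc a b, 0 < k θ)
    {c : ℝ → ℝ × ℝ} {G : ℝ × ℝ → ℝ × ℝ}
    (hc : ∀ θ ∈ Icc a b, HasDerivWithinAt c (k θ • G (c θ)) (Icc a b) θ)
    {θ : ℝ} (hθ : θ ∈ Icc a b) :
    HasDerivWithinAt (fun t => c (e.symm t)) (G (c θ)) (Icc (e a) (e b)) (e θ) := by
  have h1 := e.hasDerivWithinAt_symm hθ (hasDerivWithinAt_timeChange hab he hk hκ hθ)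
    (hpos θ hθ).ne'
  have hθ' := hc θ hθ
  rw [← e.symm_apply_apply θ] at hθ'
  have h2 := HasDerivWithinAt.scomp (e θ) hθ' h1 (by
    rintro _ ⟨y, hy, rfl⟩
    simpa using hy)
  rw [e.symm_apply_apply, inv_smul_smul₀ (hpos θ hθ).ne', e.image_Icc] at h2
  exact h2

/-- The field `F` seen after the rotation `p ↦ -p`, which exchanges the two sides. -/
def rotateField (F : ℝ × ℝ → ℝ × ℝ) : ℝ × ℝ → ℝ × ℝ := fun p => -F (-p)

theorem IsCanonicalField.rotate {F : ℝ × ℝ → ℝ × ℝ} (hF : IsCanonicalField F) :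
    IsCanonicalField (rotateField F) := by
  obtain ⟨n, P, Q, hP, hQ, hF⟩ := hF
  have hs : ∀ R : ℕ → MvPolynomial (Fin 2) ℝ, (∀ k, (R k).IsHomogeneous k) → ∀ x y : ℝ,
      ∑ k ∈ Finset.Icc 2 n, MvPolynomial.eval ![x, y] (MvPolynomial.C ((-1) ^ (k + 1)) * R k) =
        -∑ k ∈ Finset.Icc 2 n, MvPolynomial.eval ![-x, -y] (R k) := fun R hR x y => by
    rw [← Finset.sum_neg_distrib]
    refine Finset.sum_congr rfl fun k _ => ?_
    have := (hR k).eval_mul_mul (-1) x y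
    rw [neg_one_mul, neg_one_mul] at this
    rw [this, map_mul, MvPolynomial.eval_C, pow_succ]
    ring
  refine ⟨n, fun k => MvPolynomial.C ((-1) ^ (k + 1)) * P k,
    fun k => MvPolynomial.C ((-1) ^ (k + 1)) * Q k, fun k => (hP k).C_mul _,
    fun k => (hQ k).C_mul _, fun x y => ?_⟩
  rw [hs P hP, hs Q hQ]
  simp only [rotateField, Prod.neg_mk, hF, neg_add, neg_neg]

namespace PolarFlow

variable {F G : ℝ × ℝ → ℝ × ℝ} (f : PolarFlow F) (g : PolarFlow (rotateField G))

/-- The distance to the origin, as a function of the polar angle, along the orbit through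
`(ρ, 0)` of the piecewise system with fields `F` above and `G` below. The functions
`arccos (cos θ)` and `arccos (-cos θ)` reduce the angle to `[0, π]` on the two sides. -/
noncomputable def loopRadius (ρ θ : ℝ) : ℝ :=
  if 0 ≤ Real.sin θ then f.radial ρ (Real.arccos (Real.cos θ))
  else g.radial (f.ret ρ) (Real.arccos (-Real.cos θ))

/-- The orbit with radius `loopRadius`, parametrized by the polar angle. -/
noncomputable def loop (ρ θ : ℝ) : ℝ × ℝ :=
  (loopRadius f g ρ θ * Real.cos θ, loopRadius f g ρ θ * Real.sin θ)

/-- The derivative of time with respect to the polar angle along `loop`. -/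
noncomputable def loopRate (ρ θ : ℝ) : ℝ :=
  if 0 ≤ Real.sin θ then
    (f.speed (Real.arccos (Real.cos θ)) (f.radial ρ (Real.arccos (Real.cos θ))))⁻¹
  else (g.speed (Real.arccos (-Real.cos θ)) (g.radial (f.ret ρ) (Real.arccos (-Real.cos θ))))⁻¹

theorem ret_pos {ρ : ℝ} (h0 : 0 < ρ) (hρ : ρ < f.radius) : 0 < f.ret ρ := f.radial_pos h0 hρ _

theorem loopRadius_pos {ρ : ℝ} (h0 : 0 < ρ) (hρ : ρ < f.radius) (hσ : f.ret ρ < g.radius)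
    (θ : ℝ) : 0 < loopRadius f g ρ θ := by
  unfold loopRadius
  split_ifs
  · exact f.radial_pos h0 hρ _
  · exact g.radial_pos (f.ret_pos h0 hρ) hσ _

theorem loop_periodic (ρ : ℝ) : Function.Periodic (loop f g ρ) (2 * Real.pi) := fun θ => by
  simp [loop, loopRadius]

theorem loopRate_periodic (ρ : ℝ) : Function.Periodic (loopRate f g ρ) (2 * Real.pi) := fun θ => by
  simp [loopRate]

theorem arccos_cos_sub {n : ℤ} {θ : ℝ} (hθ : θ - n * (2 * Real.pi) ∈ Icc 0 Real.pi) :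
    Real.arccos (Real.cos θ) = θ - n * (2 * Real.pi) := by
  rw [← Real.cos_sub_int_mul_two_pi θ n, Real.arccos_cos hθ.1 hθ.2]

theorem arccos_neg_cos_sub {n : ℤ} {θ : ℝ} (hθ : θ - n * (2 * Real.pi) - Real.pi ∈ Icc 0 Real.pi) :
    Real.arccos (-Real.cos θ) = θ - n * (2 * Real.pi) - Real.pi := by
  rw [← Real.cos_sub_int_mul_two_pi θ n, ← Real.cos_sub_pi, Real.arccos_cos hθ.1 hθ.2]

theorem sin_nonneg_of_upper {n : ℤ} {θ : ℝ} (hθ : θ - n * (2 * Real.pi) ∈ Icc 0 Real.pi) :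
    0 ≤ Real.sin θ := by
  rw [← Real.sin_sub_int_mul_two_pi θ n]
  exact Real.sin_nonneg_of_mem_Icc hθ

theorem sin_neg_of_lower {n : ℤ} {θ : ℝ} (hθ : θ - n * (2 * Real.pi) - Real.pi ∈ Ioo 0 Real.pi) :
    Real.sin θ < 0 := by
  have := Real.sin_pos_of_mem_Ioo hθ
  rw [Real.sin_sub_pi, Real.sin_sub_int_mul_two_pi] at this
  linarith

theorem loop_upper (ρ : ℝ) {n : ℤ} {θ : ℝ} (hθ : θ - n * (2 * Real.pi) ∈ Icc 0 Real.pi) :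
    loop f g ρ θ = f.arc ρ (θ - n * (2 * Real.pi)) := by
  rw [loop, loopRadius, if_pos (sin_nonneg_of_upper hθ), arccos_cos_sub hθ, arc,
    Real.cos_sub_int_mul_two_pi, Real.sin_sub_int_mul_two_pi]

theorem loop_lower {ρ : ℝ} (hρ : |ρ| < f.radius) (hσ : |f.ret ρ| < g.radius)
    (hret : g.ret (f.ret ρ) = ρ) {n : ℤ} {θ : ℝ}
    (hθ : θ - n * (2 * Real.pi) - Real.pi ∈ Icc 0 Real.pi) :
    loop f g ρ θ = -g.arc (f.ret ρ) (θ - n * (2 * Real.pi) - Real.pi) := by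
  -- at the two ends of the half-turn `sin θ = 0`, so that `loopRadius` is given by the upper side
  rcases hθ.1.eq_or_lt with h | h
  · rw [← h, g.arc_zero hσ, f.loop_upper g ρ (n := n) (by
      rw [sub_eq_zero.1 h.symm]; exact right_mem_Icc.2 Real.pi_pos.le),
      sub_eq_zero.1 h.symm, f.arc_pi]
    simp
  rcases hθ.2.eq_or_lt with h' | h'
  · have h2 : θ - ((n + 1 : ℤ) : ℝ) * (2 * Real.pi) = 0 := by push_cast; linarith
    rw [h', g.arc_pi, f.loop_upper g ρ (n := n + 1) (by
      rw [h2]; exact left_mem_Icc.2 Real.pi_pos.le), h2, f.arc_zero hρ, hret]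
    simp
  · rw [loop, loopRadius, if_neg (sin_neg_of_lower ⟨h, h'⟩).not_ge, arccos_neg_cos_sub hθ, arc,
      Real.cos_sub_pi, Real.sin_sub_pi, Real.cos_sub_int_mul_two_pi, Real.sin_sub_int_mul_two_pi]
    simp

theorem hasDerivWithinAt_loop_upper {ρ : ℝ} (hρ : |ρ| < f.radius) (n : ℤ) {θ : ℝ}
    (hθ : θ ∈ Icc (n * (2 * Real.pi)) (n * (2 * Real.pi) + Real.pi)) :
    HasDerivWithinAt (loop f g ρ)
      ((f.speed (θ - n * (2 * Real.pi)) (f.radial ρ (θ - n * (2 * Real.pi))))⁻¹ •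
        F (loop f g ρ θ)) (Icc (n * (2 * Real.pi)) (n * (2 * Real.pi) + Real.pi)) θ := by
  have hm : ∀ x ∈ Icc (n * (2 * Real.pi)) (n * (2 * Real.pi) + Real.pi),
      x - n * (2 * Real.pi) ∈ Icc 0 Real.pi := fun x hx =>
    ⟨by linarith [hx.1], by linarith [hx.2]⟩
  rw [f.loop_upper g ρ (hm θ hθ)]
  have h := (f.hasDerivWithinAt_arc hρ (hm θ hθ)).scomp θ
    ((hasDerivAt_id θ).sub_const (n * (2 * Real.pi))).hasDerivWithinAt hm
  rw [one_smul] at h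
  exact h.congr (fun x hx => f.loop_upper g ρ (hm x hx)) (f.loop_upper g ρ (hm θ hθ))

theorem hasDerivWithinAt_loop_lower {ρ : ℝ} (hρ : |ρ| < f.radius) (hσ : |f.ret ρ| < g.radius)
    (hret : g.ret (f.ret ρ) = ρ) (n : ℤ) {θ : ℝ}
    (hθ : θ ∈ Icc (n * (2 * Real.pi) + Real.pi) (n * (2 * Real.pi) + Real.pi + Real.pi)) :
    HasDerivWithinAt (loop f g ρ)
      ((g.speed (θ - n * (2 * Real.pi) - Real.pi)
        (g.radial (f.ret ρ) (θ - n * (2 * Real.pi) - Real.pi)))⁻¹ • G (loop f g ρ θ))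
      (Icc (n * (2 * Real.pi) + Real.pi) (n * (2 * Real.pi) + Real.pi + Real.pi)) θ := by
  have hm : ∀ x ∈ Icc (n * (2 * Real.pi) + Real.pi) (n * (2 * Real.pi) + Real.pi + Real.pi),
      x - n * (2 * Real.pi) - Real.pi ∈ Icc 0 Real.pi := fun x hx =>
    ⟨by linarith [hx.1], by linarith [hx.2]⟩
  have hl : ∀ x ∈ Icc (n * (2 * Real.pi) + Real.pi) (n * (2 * Real.pi) + Real.pi + Real.pi), _ :=
    fun x hx => f.loop_lower g hρ hσ hret (hm x hx)
  rw [hl θ hθ]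
  have h := ((g.hasDerivWithinAt_arc hσ (hm θ hθ)).scomp θ
    (((hasDerivAt_id θ).sub_const (n * (2 * Real.pi))).sub_const Real.pi).hasDerivWithinAt hm).neg
  rw [one_smul] at h
  refine (h.congr hl (hl θ hθ)).congr_deriv ?_
  simp [rotateField]

/-- The change of time from the polar angle to the time of the piecewise system. -/
theorem exists_loopTime {ρ : ℝ} (hρ : |ρ| < f.radius) (hσ : |f.ret ρ| < g.radius) :
    ∃ e : ℝ ≃o ℝ, ∀ a b, e b - e a = ∫ t in a..b, loopRate f g ρ t := by
  set kp : ℝ → ℝ := fun θ => (f.speed θ (f.radial ρ θ))⁻¹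
  set km : ℝ → ℝ := fun θ => (g.speed θ (g.radial (f.ret ρ) θ))⁻¹
  have hkp : ContinuousOn kp (Icc 0 Real.pi) :=
    (f.continuousOn_speed hρ).inv₀ fun θ hθ => (f.speed_radial_pos hρ hθ).ne'
  have hkm : ContinuousOn km (Icc 0 Real.pi) :=
    (g.continuousOn_speed hσ).inv₀ fun θ hθ => (g.speed_radial_pos hσ hθ).ne'
  have hkp0 : ∀ θ ∈ Icc 0 Real.pi, 0 < kp θ := fun θ hθ => inv_pos.2 (f.speed_radial_pos hρ hθ)
  have hkm0 : ∀ θ ∈ Icc 0 Real.pi, 0 < km θ := fun θ hθ => inv_pos.2 (g.speed_radial_pos hσ hθ)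
  have hne : (Icc 0 Real.pi).Nonempty := ⟨0, left_mem_Icc.2 Real.pi_pos.le⟩
  obtain ⟨x, hx, hxmin⟩ := isCompact_Icc.exists_isMinOn hne hkp
  obtain ⟨y, hy, hymin⟩ := isCompact_Icc.exists_isMinOn hne hkm
  have hmem : ∀ z, Real.arccos z ∈ Icc 0 Real.pi := fun z =>
    ⟨Real.arccos_nonneg _, Real.arccos_le_pi _⟩
  have hcp : Continuous fun θ => kp (Real.arccos (Real.cos θ)) :=
    hkp.comp_continuous (Real.continuous_arccos.comp Real.continuous_cos) fun _ => hmem _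
  have hcm : Continuous fun θ => km (Real.arccos (-Real.cos θ)) :=
    hkm.comp_continuous (Real.continuous_arccos.comp Real.continuous_cos.neg) fun _ => hmem _
  refine exists_orderIso_of_integral (m := min (kp x) (km y)) (lt_min (hkp0 x hx) (hkm0 y hy))
    (fun t => ?_) fun a b => ?_
  · unfold loopRate
    split_ifs
    · exact (min_le_left _ _).trans (hxmin (hmem _))
    · exact (min_le_right _ _).trans (hymin (hmem _))
  · refine ((hcp.add hcm).intervalIntegrable a b).mono_fun' ?_ (.of_forall fun t => ?_)
    · exact (Measurable.ite (measurableSet_le measurable_const Real.measurable_sin)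
        hcp.measurable hcm.measurable).aestronglyMeasurable
    · have h1 := hkp0 _ (hmem (Real.cos t))
      have h2 := hkm0 _ (hmem (-Real.cos t))
      simp only [loopRate, Pi.add_apply]
      split_ifs
      · change ‖kp _‖ ≤ kp _ + km _
        rw [Real.norm_of_nonneg h1.le]; linarith
      · change ‖km _‖ ≤ kp _ + km _
        rw [Real.norm_of_nonneg h2.le]; linarith

end PolarFlow

/-! ### The center -/

/-- The crossing condition at a point with polar angle `0`. -/
theorem PolarFlow.snd_pos_of_fst_pos {F : ℝ × ℝ → ℝ × ℝ} (f : PolarFlow F) {r : ℝ} (h0 : 0 < r)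
    (hr : r < 2 * f.radius) : 0 < (F (r, 0)).2 := by
  have h : |r| < 2 * f.radius := by rwa [abs_of_pos h0]
  have hm := left_mem_Icc.2 Real.pi_pos.le
  have := f.polar 0 hm r h
  simp only [Real.cos_zero, Real.sin_zero, mul_one, mul_zero] at this
  rw [this]
  simpa using mul_pos (f.speed_pos 0 hm r h) h0

/-- The crossing condition at a point with polar angle `π`. -/
theorem PolarFlow.snd_neg_of_fst_neg {F : ℝ × ℝ → ℝ × ℝ} (f : PolarFlow F) {r : ℝ} (h0 : 0 < r)
    (hr : r < 2 * f.radius) : (F (-r, 0)).2 < 0 := by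
  have h : |r| < 2 * f.radius := by rwa [abs_of_pos h0]
  have hm := right_mem_Icc.2 Real.pi_pos.le
  have := f.polar Real.pi hm r h
  simp only [Real.cos_pi, Real.sin_pi, mul_zero, mul_neg, mul_one] at this
  rw [this]
  simpa using mul_pos (f.speed_pos Real.pi hm r h) h0

theorem polar_injective {r s θ φ : ℝ} (hr : 0 < r) (hs : 0 < s)
    (h : (r * Real.cos θ, r * Real.sin θ) = (s * Real.cos φ, s * Real.sin φ)) :
    ∃ k : ℤ, θ - φ = 2 * Real.pi * k := by
  have h1 := polarRadius_polar hr.le θ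
  rw [h, polarRadius_polar hs.le] at h1
  subst h1
  rw [Prod.mk.injEq] at h
  exact Real.Angle.angle_eq_iff_two_pi_dvd_sub.1
    (Real.Angle.cos_sin_inj (mul_left_cancel₀ hs.ne' h.1) (mul_left_cancel₀ hs.ne' h.2))

namespace PolarFlow

variable {Z : PiecewiseField} (f : PolarFlow Z.upper) (g : PolarFlow (rotateField Z.lower))

/-- If the two half-returns compose to the identity at `ρ`, then the loop through `(ρ, 0)`, run
through in the time of the system, is a solution that crosses the line. -/
theorem loop_isCrossingSolution {ρ : ℝ} (h0 : 0 < ρ) (hρ : ρ < f.radius)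
    (hσ : f.ret ρ < g.radius) (hret : g.ret (f.ret ρ) = ρ) {e : ℝ ≃o ℝ}
    (he : ∀ a b, e b - e a = ∫ t in a..b, loopRate f g ρ t) :
    Z.IsCrossingSolution fun t => loop f g ρ (e.symm t) := by
  have hπ := Real.pi_pos
  have hρ' : |ρ| < f.radius := by rwa [abs_of_pos h0]
  have hσ0 := f.ret_pos h0 hρ
  have hσ' : |f.ret ρ| < g.radius := by rwa [abs_of_pos hσ0]
  have hup : ∀ (n : ℤ), ∀ θ ∈ Icc (n * (2 * Real.pi)) (n * (2 * Real.pi) + Real.pi),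
      HasDerivWithinAt (fun t => loop f g ρ (e.symm t)) (Z.upper (loop f g ρ θ))
        (Icc (e (n * (2 * Real.pi))) (e (n * (2 * Real.pi) + Real.pi))) (e θ) := by
    intro n θ hθ
    have hm : ∀ x ∈ Icc (n * (2 * Real.pi)) (n * (2 * Real.pi) + Real.pi),
        x - n * (2 * Real.pi) ∈ Icc 0 Real.pi := fun x hx =>
      ⟨by linarith [hx.1], by linarith [hx.2]⟩
    refine hasDerivWithinAt_comp_symm (by linarith) he
      (k := fun x => (f.speed (x - n * (2 * Real.pi)) (f.radial ρ (x - n * (2 * Real.pi))))⁻¹)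
      ?_ (fun x hx => ?_) (fun x hx => inv_pos.2 (f.speed_radial_pos hρ' (hm x hx)))
      (fun x hx => f.hasDerivWithinAt_loop_upper g hρ' n hx) hθ
    · exact ((f.continuousOn_speed hρ').inv₀ fun x hx => (f.speed_radial_pos hρ' hx).ne').comp
        (by fun_prop : ContinuousOn (fun x => x - n * (2 * Real.pi)) _) hm
    · have := hm x (Ioo_subset_Icc_self hx)
      rw [loopRate, if_pos (sin_nonneg_of_upper this), arccos_cos_sub this]
  have hlo : ∀ (n : ℤ), ∀ θ ∈ Icc (n * (2 * Real.pi) + Real.pi)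
      (n * (2 * Real.pi) + Real.pi + Real.pi),
      HasDerivWithinAt (fun t => loop f g ρ (e.symm t)) (Z.lower (loop f g ρ θ))
        (Icc (e (n * (2 * Real.pi) + Real.pi)) (e (n * (2 * Real.pi) + Real.pi + Real.pi)))
        (e θ) := by
    intro n θ hθ
    have hm : ∀ x ∈ Icc (n * (2 * Real.pi) + Real.pi) (n * (2 * Real.pi) + Real.pi + Real.pi),
        x - n * (2 * Real.pi) - Real.pi ∈ Icc 0 Real.pi := fun x hx =>
      ⟨by linarith [hx.1], by linarith [hx.2]⟩
    refine hasDerivWithinAt_comp_symm (by linarith) he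
      (k := fun x => (g.speed (x - n * (2 * Real.pi) - Real.pi)
        (g.radial (f.ret ρ) (x - n * (2 * Real.pi) - Real.pi)))⁻¹)
      ?_ (fun x hx => ?_) (fun x hx => inv_pos.2 (g.speed_radial_pos hσ' (hm x hx)))
      (fun x hx => f.hasDerivWithinAt_loop_lower g hρ' hσ' hret n hx) hθ
    · exact ((g.continuousOn_speed hσ').inv₀ fun x hx => (g.speed_radial_pos hσ' hx).ne').comp
        (by fun_prop : ContinuousOn (fun x => x - n * (2 * Real.pi) - Real.pi) _) hm
    · have h1 := hm x (Ioo_subset_Icc_self hx)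
      have h2 : x - n * (2 * Real.pi) - Real.pi ∈ Ioo 0 Real.pi :=
        ⟨by linarith [hx.1], by linarith [hx.2]⟩
      rw [loopRate, if_neg (sin_neg_of_lower h2).not_ge, arccos_neg_cos_sub h1]
  -- every angle is a multiple of `π` or lies strictly inside one of the two half-turns
  have hcases : ∀ θ : ℝ, ∃ n : ℤ, θ = n * (2 * Real.pi) ∨ θ = n * (2 * Real.pi) + Real.pi ∨
      θ ∈ Ioo (n * (2 * Real.pi)) (n * (2 * Real.pi) + Real.pi) ∨
      θ ∈ Ioo (n * (2 * Real.pi) + Real.pi) (n * (2 * Real.pi) + Real.pi + Real.pi) := by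
    intro θ
    obtain ⟨n, ⟨h1, h2⟩, -⟩ := existsUnique_zsmul_near_of_pos Real.two_pi_pos θ
    rw [zsmul_eq_mul] at h1 h2
    push_cast at h2
    refine ⟨n, ?_⟩
    rcases h1.eq_or_lt with h | h
    · exact .inl h.symm
    rcases lt_trichotomy θ (n * (2 * Real.pi) + Real.pi) with h' | h' | h'
    · exact .inr (.inr (.inl ⟨h, h'⟩))
    · exact .inr (.inl h')
    · exact .inr (.inr (.inr ⟨h', by linarith⟩))
  have hpos := f.loopRadius_pos g h0 hρ hσ
  have hsnd_up : ∀ (n : ℤ) θ, θ ∈ Ioo (n * (2 * Real.pi)) (n * (2 * Real.pi) + Real.pi) →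
      0 < (loop f g ρ θ).2 := fun n θ hθ => by
    refine mul_pos (hpos θ) ?_
    rw [← Real.sin_sub_int_mul_two_pi θ n]
    exact Real.sin_pos_of_mem_Ioo ⟨by linarith [hθ.1], by linarith [hθ.2]⟩
  have hsnd_lo : ∀ (n : ℤ) θ, θ ∈ Ioo (n * (2 * Real.pi) + Real.pi)
      (n * (2 * Real.pi) + Real.pi + Real.pi) → (loop f g ρ θ).2 < 0 := fun n θ hθ =>
    mul_neg_of_pos_of_neg (hpos θ)
      (sin_neg_of_lower (n := n) ⟨by linarith [hθ.1], by linarith [hθ.2]⟩)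
  have hzero : ∀ n : ℤ, loop f g ρ (n * (2 * Real.pi)) = (ρ, 0) := fun n => by
    rw [f.loop_upper g ρ (n := n) (by rw [sub_self]; exact left_mem_Icc.2 hπ.le), sub_self,
      f.arc_zero hρ']
  have hpi : ∀ n : ℤ, loop f g ρ (n * (2 * Real.pi) + Real.pi) = (-f.ret ρ, 0) := fun n => by
    rw [f.loop_upper g ρ (n := n) (by rw [add_sub_cancel_left]; exact right_mem_Icc.2 hπ.le),
      add_sub_cancel_left, f.arc_pi]
  have hρ2 : ρ < 2 * g.radius := by
    have := g.abs_radial_lt hσ' Real.pi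
    change |g.ret (f.ret ρ)| < _ at this
    rwa [hret, abs_of_pos h0] at this
  have hσ2 : f.ret ρ < 2 * f.radius := (le_abs_self _).trans_lt (f.abs_radial_lt hρ' Real.pi)
  refine ⟨fun t => ?_, fun t => ?_, fun t => ?_⟩
  · obtain ⟨θ, rfl⟩ := e.surjective t
    simp only [e.symm_apply_apply]
    intro ht
    obtain ⟨n, rfl | rfl | h | h⟩ := hcases θ
    · rw [hzero] at ht; exact absurd ht (lt_irrefl _)
    · rw [hpi] at ht; exact absurd ht (lt_irrefl _)
    · exact (hup n θ (Ioo_subset_Icc_self h)).hasDerivAt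
        (Icc_mem_nhds (e.lt_iff_lt.2 h.1) (e.lt_iff_lt.2 h.2))
    · exact absurd ht (hsnd_lo n θ h).not_gt
  · obtain ⟨θ, rfl⟩ := e.surjective t
    simp only [e.symm_apply_apply]
    intro ht
    obtain ⟨n, rfl | rfl | h | h⟩ := hcases θ
    · rw [hzero] at ht; exact absurd ht (lt_irrefl _)
    · rw [hpi] at ht; exact absurd ht (lt_irrefl _)
    · exact absurd ht (hsnd_up n θ h).not_gt
    · exact (hlo n θ (Ioo_subset_Icc_self h)).hasDerivAt
        (Icc_mem_nhds (e.lt_iff_lt.2 h.1) (e.lt_iff_lt.2 h.2))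
  · obtain ⟨θ, rfl⟩ := e.surjective t
    simp only [e.symm_apply_apply]
    intro ht
    obtain ⟨n, rfl | rfl | h | h⟩ := hcases θ
    · refine .inl ⟨?_, ?_, ?_, ?_⟩
      · rw [hzero]
        exact f.snd_pos_of_fst_pos h0 (by linarith)
      · rw [hzero]
        have := g.snd_neg_of_fst_neg h0 hρ2
        simpa [rotateField] using this
      · have hn : ((n - 1 : ℤ) : ℝ) * (2 * Real.pi) + Real.pi + Real.pi = n * (2 * Real.pi) := by
          push_cast; ring
        have h := hlo (n - 1) (n * (2 * Real.pi)) ⟨by linarith, hn.ge⟩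
        rw [hn] at h
        exact h.mono_of_mem_nhdsWithin (Icc_mem_nhdsLE (e.lt_iff_lt.2 (by linarith)))
      · exact (hup n _ ⟨le_rfl, by linarith⟩).mono_of_mem_nhdsWithin
          (Icc_mem_nhdsGE (e.lt_iff_lt.2 (by linarith)))
    · refine .inr ⟨?_, ?_, ?_, ?_⟩
      · rw [hpi]
        exact f.snd_neg_of_fst_neg hσ0 hσ2
      · rw [hpi]
        have := g.snd_pos_of_fst_pos hσ0 (by linarith)
        simpa [rotateField] using this
      · exact (hup n _ ⟨by linarith, le_rfl⟩).mono_of_mem_nhdsWithin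
          (Icc_mem_nhdsLE (e.lt_iff_lt.2 (by linarith)))
      · exact (hlo n _ ⟨le_rfl, by linarith⟩).mono_of_mem_nhdsWithin
          (Icc_mem_nhdsGE (e.lt_iff_lt.2 (by linarith)))
    · exact absurd ht (hsnd_up n θ h).ne'
    · exact absurd ht (hsnd_lo n θ h).ne

/-- A loop that closes up is a crossing periodic orbit, which may be started at any angle `θ₀`. -/
theorem exists_isCrossingPeriodicOrbit {ρ : ℝ} (h0 : 0 < ρ) (hρ : ρ < f.radius)
    (hσ : f.ret ρ < g.radius) (hret : g.ret (f.ret ρ) = ρ) (θ₀ : ℝ) :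
    ∃ (γ : ℝ → ℝ × ℝ) (T : ℝ), Z.IsCrossingPeriodicOrbit γ T ∧ γ 0 = loop f g ρ θ₀ ∧
      ∀ t, γ t ∈ range (loop f g ρ) := by
  have hπ := Real.pi_pos
  obtain ⟨e, he⟩ := f.exists_loopTime g (ρ := ρ) (by rwa [abs_of_pos h0])
    (by rwa [abs_of_pos (f.ret_pos h0 hρ)])
  have hsol := f.loop_isCrossingSolution g h0 hρ hσ hret he
  have hpos := f.loopRadius_pos g h0 hρ hσ
  set T := e (2 * Real.pi) - e 0 with hT
  have heT : ∀ θ, e (θ + 2 * Real.pi) = e θ + T := fun θ => by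
    have h1 := (f.loopRate_periodic g ρ).intervalIntegral_add_eq θ 0
    rw [← he, ← he, zero_add] at h1
    linarith
  have hT0 : 0 < T := sub_pos.2 (e.lt_iff_lt.2 (by linarith))
  have hsymm : ∀ s, e.symm (s + T) = e.symm s + 2 * Real.pi := fun s => by
    rw [e.symm_apply_eq, heT, e.apply_symm_apply]
  have hwin : ∀ t ∈ Ico 0 T, e.symm (t + e θ₀) ∈ Ico θ₀ (θ₀ + 2 * Real.pi) := fun t ht => by
    constructor
    · rw [e.le_symm_apply]; linarith [ht.1]
    · rw [e.symm_apply_lt, heT]; linarith [ht.2]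
  -- each half-axis is met exactly at the angles `b + 2πn`, one of which is in the window
  have hcross : ∀ (b : ℝ) (q : ℝ × ℝ → Prop),
      (∀ θ, q (loop f g ρ θ) ↔ ∃ n : ℤ, θ = b + n • (2 * Real.pi)) →
      ∃! t, t ∈ Ico 0 T ∧ q (loop f g ρ (e.symm (t + e θ₀))) := by
    intro b q hq
    obtain ⟨n, hn, huniq⟩ := existsUnique_add_zsmul_mem_Ico Real.two_pi_pos b θ₀
    refine ⟨e (b + n • (2 * Real.pi)) - e θ₀, ⟨⟨?_, ?_⟩, ?_⟩, ?_⟩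
    · exact sub_nonneg.2 (e.le_iff_le.2 hn.1)
    · rw [sub_lt_iff_lt_add', ← heT]
      exact e.lt_iff_lt.2 hn.2
    · rw [sub_add_cancel, e.symm_apply_apply, hq]
      exact ⟨n, rfl⟩
    · rintro t ⟨ht, hqt⟩
      obtain ⟨m, hm⟩ := (hq _).1 hqt
      have hw := hwin t ht
      rw [hm] at hw
      rw [← huniq m hw, ← hm, e.apply_symm_apply, add_sub_cancel_right]
  refine ⟨fun t => loop f g ρ (e.symm (t + e θ₀)), T,
    ⟨⟨fun t ht => ?_, fun t ht => ?_, fun t ht => ?_⟩, hT0, fun t => ?_, ?_, ?_, ?_⟩,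
    by simp, fun t => mem_range_self _⟩
  · exact (hsol.on_upper _ ht).comp_add_const t (e θ₀)
  · exact (hsol.on_lower _ ht).comp_add_const t (e θ₀)
  · have hshift : ∀ (v : ℝ × ℝ) (s s' : Set ℝ), MapsTo (fun x => x + e θ₀) s s' →
        HasDerivWithinAt (fun t => loop f g ρ (e.symm t)) v s' (t + e θ₀) →
        HasDerivWithinAt (fun t => loop f g ρ (e.symm (t + e θ₀))) v s t := by
      intro v s s' hm h
      have := h.scomp t ((hasDerivAt_id t).add_const (e θ₀)).hasDerivWithinAt hm
      rwa [one_smul] at this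
    have hle : MapsTo (fun x => x + e θ₀) (Iic t) (Iic (t + e θ₀)) := fun x hx => by
      simpa using hx
    have hge : MapsTo (fun x => x + e θ₀) (Ici t) (Ici (t + e θ₀)) := fun x hx => by
      simpa using hx
    rcases hsol.on_line _ ht with ⟨h1, h2, h3, h4⟩ | ⟨h1, h2, h3, h4⟩
    · exact .inl ⟨h1, h2, hshift _ _ _ hle h3, hshift _ _ _ hge h4⟩
    · exact .inr ⟨h1, h2, hshift _ _ _ hle h3, hshift _ _ _ hge h4⟩
  · rw [add_right_comm, hsymm, f.loop_periodic g ρ]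
  · intro s hs t ht hst
    obtain ⟨k, hk⟩ := polar_injective (hpos _) (hpos _) hst
    have h1 := hwin s hs
    have h2 := hwin t ht
    have hk0 : k = 0 := by
      have h3 : 2 * Real.pi * k < 2 * Real.pi * 1 := by linarith [h1.2, h2.1]
      have h4 : 2 * Real.pi * (-1) < 2 * Real.pi * k := by linarith [h1.1, h2.2]
      have h5 : (k : ℝ) < 1 := lt_of_mul_lt_mul_left h3 (by linarith)
      have h6 : (-1 : ℝ) < k := lt_of_mul_lt_mul_left h4 (by linarith)
      have h5' : k < 1 := by exact_mod_cast h5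
      have h6' : -1 < k := by exact_mod_cast h6
      omega
    rw [hk0, Int.cast_zero, mul_zero, sub_eq_zero] at hk
    exact add_right_cancel (e.symm.injective hk)
  · refine hcross 0 (fun p => p.2 = 0 ∧ 0 < p.1) fun θ => ?_
    have : (loop f g ρ θ).2 = 0 ∧ 0 < (loop f g ρ θ).1 ↔ Real.sin θ = 0 ∧ 0 < Real.cos θ := by
      simp only [loop, mul_eq_zero, (hpos θ).ne', false_or, mul_pos_iff_of_pos_left (hpos θ)]
    rw [this]
    constructor
    · rintro ⟨h1, h2⟩
      have h3 : Real.cos θ = 1 := by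
        rcases Real.sin_eq_zero_iff_cos_eq.1 h1 with h | h
        · exact h
        · rw [h] at h2; norm_num at h2
      obtain ⟨n, hn⟩ := (Real.cos_eq_one_iff θ).1 h3
      exact ⟨n, by rw [zsmul_eq_mul, zero_add, hn]⟩
    · rintro ⟨n, rfl⟩
      rw [zsmul_eq_mul, Real.sin_add_int_mul_two_pi, Real.cos_add_int_mul_two_pi]
      simp
  · refine hcross Real.pi (fun p => p.2 = 0 ∧ p.1 < 0) fun θ => ?_
    have : (loop f g ρ θ).2 = 0 ∧ (loop f g ρ θ).1 < 0 ↔ Real.sin θ = 0 ∧ Real.cos θ < 0 := by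
      simp only [loop, mul_eq_zero, (hpos θ).ne', false_or, mul_neg_iff, hpos θ, true_and,
        (hpos θ).not_gt, false_and, or_false]
    rw [this]
    constructor
    · rintro ⟨h1, h2⟩
      have h3 : Real.cos θ = -1 := by
        rcases Real.sin_eq_zero_iff_cos_eq.1 h1 with h | h
        · rw [h] at h2; norm_num at h2
        · exact h
      obtain ⟨n, hn⟩ := Real.cos_eq_neg_one_iff.1 h3
      exact ⟨n, by rw [zsmul_eq_mul, hn]⟩
    · rintro ⟨n, rfl⟩
      rw [zsmul_eq_mul, Real.sin_add_int_mul_two_pi, Real.cos_add_int_mul_two_pi]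
      simp

/-- If every orbit close to the origin closes up after the two half-turns, the origin is a
center. -/
theorem isCenter_of_ret_ret (h : ∀ᶠ ρ in 𝓝[>] (0 : ℝ), g.ret (f.ret ρ) = ρ) : Z.IsCenter := by
  obtain ⟨ε₀, hε₀, hε₀'⟩ := mem_nhdsGT_iff_exists_Ioo_subset.1 h
  rw [mem_Ioi] at hε₀
  set ε := min ε₀ (min f.radius (g.radius / 2)) with hε
  have hfr := f.radius_pos
  have hgr := g.radius_pos
  have hεpos : 0 < ε := lt_min hε₀ (lt_min hfr (by linarith))
  have hε1 : ε ≤ ε₀ := min_le_left _ _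
  have hε2 : ε ≤ f.radius := (min_le_right _ _).trans (min_le_left _ _)
  have hε3 : ε ≤ g.radius / 2 := (min_le_right _ _).trans (min_le_right _ _)
  have hsmall : ∀ ρ ∈ Ioo 0 ε, ρ < f.radius ∧ f.ret ρ < g.radius ∧ g.ret (f.ret ρ) = ρ :=
    fun ρ hρ => by
    have h1 := hρ.2.trans_le hε2
    have h2 : f.ret ρ ≤ _ := f.radial_le hρ.1 h1 Real.pi
    exact ⟨h1, by linarith [hρ.2], hε₀' ⟨hρ.1, hρ.2.trans_le hε1⟩⟩
  have hnear : ∀ᶠ p : ℝ × ℝ in 𝓝 0, 3 * polarRadius p < ε := by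
    have hc : ContinuousAt (fun p => 3 * polarRadius p) 0 :=
      (continuous_const.mul continuous_polarRadius).continuousAt
    exact hc.eventually (gt_mem_nhds (by simpa [polarRadius_zero] using hεpos))
  refine ⟨{0} ∪ ⋃ ρ ∈ Ioo 0 ε, range (loop f g ρ), ?_, ?_⟩
  · filter_upwards [hnear] with p hp
    by_cases h0 : p = 0
    · exact .inl h0
    have hr := polarRadius_pos h0
    right
    simp only [mem_iUnion]
    rcases le_or_gt 0 p.2 with hy | hy
    · have hp2 : 2 * polarRadius p < f.radius := by linarith
      obtain ⟨⟨h1, h2⟩, -⟩ := f.label_spec h0 hp2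
      refine ⟨f.label p, ⟨h1, by linarith [f.label_le h0 hp2]⟩, polarAngle p, ?_⟩
      rw [f.loop_upper g _ (n := 0) (by simpa using polarAngle_mem p)]
      simpa using f.arc_label h0 hy hp2
    · -- the arc of the lower side through `p` starts at `(-σ, 0)`, and the loop through `p` meets
      -- the positive half-axis at `g.ret σ`
      have hneg : polarRadius (-p) = polarRadius p := by simp [polarRadius]
      have h0' : -p ≠ 0 := neg_ne_zero.2 h0
      have hp2 : 2 * polarRadius (-p) < g.radius := by rw [hneg]; linarith
      obtain ⟨⟨h1, h2⟩, -⟩ := g.label_spec h0' hp2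
      set σ := g.label (-p) with hσ
      have hσle : σ ≤ 2 * polarRadius p := hneg ▸ g.label_le h0' hp2
      have hρle : g.ret σ ≤ _ := g.radial_le h1 h2 Real.pi
      have hρpos : 0 < g.ret σ := g.ret_pos h1 h2
      have hρε : g.ret σ < ε := by linarith
      obtain ⟨hs1, hs2, hs3⟩ := hsmall _ ⟨hρpos, hρε⟩
      have hfσ : f.ret (g.ret σ) = σ := by
        refine (g.radial_strictMono Real.pi).injOn ⟨?_, hs2⟩ ⟨by linarith, h2⟩ hs3
        linarith [f.ret_pos hρpos hs1]
      refine ⟨g.ret σ, ⟨hρpos, hρε⟩, polarAngle (-p) + Real.pi, ?_⟩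
      rw [f.loop_lower g (by rwa [abs_of_pos hρpos]) (by rw [hfσ]; rwa [abs_of_pos h1]) hs3
        (n := 0) (by simpa using polarAngle_mem (-p)), hfσ]
      have := g.arc_label h0' (by simpa using hy.le) hp2
      simp only [Int.cast_zero, zero_mul, sub_zero, add_sub_cancel_right]
      rw [hσ, this, neg_neg]
  · rintro p (hp | hp) h0
    · exact absurd hp h0
    simp only [mem_iUnion] at hp
    obtain ⟨ρ, hρ, θ, rfl⟩ := hp
    obtain ⟨h1, h2, h3⟩ := hsmall ρ hρ
    obtain ⟨γ, T, h4, h5, h6⟩ := f.exists_isCrossingPeriodicOrbit g hρ.1 h1 h2 h3 θ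
    exact ⟨γ, T, h4, h5, fun t => .inr (mem_iUnion₂.2 ⟨ρ, hρ, h6 t⟩)⟩

end PolarFlow

/-! ### Maps that carry orbits to orbits -/

theorem closure_upperSide : closure upperSide = {p | 0 ≤ p.2} := by
  have := (isOpenMap_snd (X := ℝ) (Y := ℝ)).preimage_closure_eq_closure_preimage
    continuous_snd (Ioi (0 : ℝ))
  rw [closure_Ioi] at this
  exact this.symm

/-- A local homeomorphism at the origin that fixes the origin and preserves the upper side. -/
structure IsSideMap (ψ : OpenPartialHomeomorph (ℝ × ℝ) (ℝ × ℝ)) : Prop where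
  zero_mem : (0 : ℝ × ℝ) ∈ ψ.source
  map_zero : ψ 0 = 0
  side : ∀ p ∈ ψ.source, ψ p ∈ upperSide ↔ p ∈ upperSide

namespace IsSideMap

variable {ψ : OpenPartialHomeomorph (ℝ × ℝ) (ℝ × ℝ)} (hψ : IsSideMap ψ)
include hψ

theorem zero_mem_target : (0 : ℝ × ℝ) ∈ ψ.target := hψ.map_zero ▸ ψ.map_source hψ.zero_mem

theorem symm_zero : ψ.symm 0 = 0 := by
  rw [← hψ.map_zero, ψ.left_inv hψ.zero_mem, hψ.map_zero]

theorem symm : IsSideMap ψ.symm where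
  zero_mem := hψ.zero_mem_target
  map_zero := hψ.symm_zero
  side p hp := by
    rw [← hψ.side _ (ψ.map_target hp), ψ.right_inv hp]

theorem source_mem_nhds : ψ.source ∈ 𝓝 0 := ψ.open_source.mem_nhds hψ.zero_mem

theorem tendsto : Tendsto ψ (𝓝 0) (𝓝 0) := by
  have := (ψ.continuousAt hψ.zero_mem).tendsto
  rwa [hψ.map_zero] at this

theorem snd_nonneg {p : ℝ × ℝ} (hp : p ∈ ψ.source) (h : 0 ≤ p.2) : 0 ≤ (ψ p).2 := by
  have h1 : p ∈ closure (ψ.source ∩ upperSide) := by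
    refine ψ.open_source.inter_closure ⟨hp, ?_⟩
    rw [closure_upperSide]
    exact h
  have h2 : ψ p ∈ closure upperSide :=
    (ψ.continuousAt hp).continuousWithinAt.mem_closure h1 fun q hq =>
      (hψ.side q hq.1).2 hq.2
  rwa [closure_upperSide] at h2

theorem snd_eq_zero {x : ℝ} (hx : (x, (0 : ℝ)) ∈ ψ.source) : (ψ (x, 0)).2 = 0 := by
  refine le_antisymm (not_lt.1 fun h => ?_) (hψ.snd_nonneg hx le_rfl)
  exact lt_irrefl (0 : ℝ) ((hψ.side _ hx).1 h)

theorem ne_zero {p : ℝ × ℝ} (hp : p ∈ ψ.source) (h : p ≠ 0) : ψ p ≠ 0 := fun h0 =>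
  h (ψ.injOn hp hψ.zero_mem (h0.trans hψ.map_zero.symm))

end IsSideMap

/-- At `p`, the differentiable map `Φ` carries the direction of the field `F` to the direction
of the field `G`, up to a factor of any sign. -/
def CarriesDirection (Φ : ℝ × ℝ → ℝ × ℝ) (F G : ℝ × ℝ → ℝ × ℝ) (p : ℝ × ℝ) : Prop :=
  ∃ (L : ℝ × ℝ →L[ℝ] ℝ × ℝ) (k : ℝ), HasFDerivAt Φ L p ∧ L (F p) = k • G (Φ p)

theorem CarriesDirection.comp {Φ Ψ : ℝ × ℝ → ℝ × ℝ} {F G K : ℝ × ℝ → ℝ × ℝ} {p : ℝ × ℝ}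
    (hΨ : CarriesDirection Ψ G K (Φ p)) (hΦ : CarriesDirection Φ F G p) :
    CarriesDirection (fun q => Ψ (Φ q)) F K p := by
  obtain ⟨L, k, hL, h⟩ := hΦ
  obtain ⟨M, l, hM, h'⟩ := hΨ
  refine ⟨M.comp L, k * l, hM.comp p hL, ?_⟩
  rw [ContinuousLinearMap.comp_apply, h, map_smul, h', smul_smul]

theorem TransformsField.carriesDirection {ψ : OpenPartialHomeomorph (ℝ × ℝ) (ℝ × ℝ)}
    {S : Set (ℝ × ℝ)} {F G : ℝ × ℝ → ℝ × ℝ} (h : TransformsField ψ S F G) {p : ℝ × ℝ}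
    (hp : p ∈ ψ.source ∩ S) : CarriesDirection ψ F G p := by
  obtain ⟨c, -, h⟩ := h
  obtain ⟨hc, L, hL, hG⟩ := h p hp
  exact ⟨L, (c p)⁻¹, hL, by rw [hG, inv_smul_smul₀ hc.ne']; rfl⟩

theorem TransformsField.carriesDirection_symm {ψ : OpenPartialHomeomorph (ℝ × ℝ) (ℝ × ℝ)}
    {S : Set (ℝ × ℝ)} {F G : ℝ × ℝ → ℝ × ℝ} (h : TransformsField ψ S F G) {q : ℝ × ℝ}
    (hq : q ∈ ψ.target) (hS : ψ.symm q ∈ S) : CarriesDirection ψ.symm G F q := by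
  obtain ⟨c, -, h⟩ := h
  obtain ⟨hc, L, hL, hG⟩ := h _ ⟨ψ.map_target hq, hS⟩
  refine ⟨(L.symm : (ℝ × ℝ) →L[ℝ] (ℝ × ℝ)), c (ψ.symm q), ψ.hasFDerivAt_symm hq hL, ?_⟩
  rw [ψ.right_inv hq] at hG
  rw [hG, map_smul]
  simp

/-- The reflection `(x, y) ↦ (-x, y)`. -/
def reflectX : ℝ × ℝ →L[ℝ] ℝ × ℝ :=
  (-ContinuousLinearMap.fst ℝ ℝ ℝ).prod (ContinuousLinearMap.snd ℝ ℝ ℝ)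

theorem reflectX_apply (p : ℝ × ℝ) : reflectX p = (-p.1, p.2) := rfl

theorem norm_le_polarRadius (p : ℝ × ℝ) : ‖p‖ ≤ polarRadius p :=
  max_le (abs_fst_le_polarRadius p) (Real.abs_le_sqrt (by nlinarith [sq_nonneg p.1]))

namespace PolarFlow

variable {F : ℝ × ℝ → ℝ × ℝ} (f : PolarFlow F)

theorem eventually_small : ∀ᶠ ρ in 𝓝[>] (0 : ℝ), 0 < ρ ∧ ρ < f.radius := by
  filter_upwards [Ioo_mem_nhdsGT f.radius_pos] with ρ hρ using hρ

theorem eventually_arc_mem {U : Set (ℝ × ℝ)} (hU : U ∈ 𝓝 0) :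
    ∀ᶠ ρ in 𝓝[>] (0 : ℝ), ∀ θ, f.arc ρ θ ∈ U := by
  obtain ⟨ε, hε, hεU⟩ := Metric.mem_nhds_iff.1 hU
  filter_upwards [f.eventually_small, Ioo_mem_nhdsGT (show 0 < ε / 2 by linarith)] with ρ h hρ θ
  refine hεU ?_
  rw [mem_ball_zero_iff]
  refine (norm_le_polarRadius _).trans_lt ?_
  have h1 := f.radial_le h.1 h.2 θ
  rw [arc, polarRadius_polar (f.radial_pos h.1 h.2 θ).le]
  linarith [hρ.2]

theorem tendsto_ret : Tendsto f.ret (𝓝[>] 0) (𝓝[>] 0) := by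
  refine tendsto_nhdsWithin_iff.2 ⟨?_, ?_⟩
  · have h := f.analytic_return.continuousAt.tendsto
    rw [f.radial_zero] at h
    exact h.mono_left nhdsWithin_le_nhds
  · filter_upwards [f.eventually_small] with ρ hρ using f.ret_pos hρ.1 hρ.2

theorem label_pos_axis {ρ : ℝ} (h0 : 0 < ρ) (hρ : ρ < f.radius) : f.label (ρ, 0) = ρ := by
  have := f.label_arc h0 hρ (left_mem_Icc.2 Real.pi_pos.le)
  rwa [f.arc_zero (by rwa [abs_of_pos h0])] at this

theorem label_neg_axis {x : ℝ} (h0 : 0 < x) (hx : 2 * x < f.radius) :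
    f.ret (f.label (-x, 0)) = x := by
  have hr : polarRadius (-x, 0) = x := by
    simpa [polarRadius] using Real.sqrt_sq h0.le
  have ha : polarAngle (-x, 0) = Real.pi := by
    rw [polarAngle, hr]
    simp [neg_div, div_self h0.ne']
  have h := f.arc_label (p := (-x, 0)) (by simp [h0.ne']) le_rfl (by rwa [hr])
  rw [ha, f.arc_pi, Prod.mk.injEq] at h
  linarith [h.1]

/-- A map of the closed upper half-plane near the origin that carries the orbits of `F` to the
orbits of `G` carries the two ends of a half-orbit of `F` to the two ends of a half-orbit
of `G`. -/
theorem eventually_label_eq {G : ℝ × ℝ → ℝ × ℝ} (g : PolarFlow G) {Φ : ℝ × ℝ → ℝ × ℝ}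
    {U : Set (ℝ × ℝ)} (hU : U ∈ 𝓝 0) (hc : ContinuousOn Φ U) (h0 : Φ 0 = 0)
    (hne : ∀ p ∈ U, p ≠ 0 → Φ p ≠ 0) (hup : ∀ p ∈ U ∩ upperSide, Φ p ∈ upperSide)
    (hdir : ∀ p ∈ U ∩ upperSide, CarriesDirection Φ F G p) :
    ∀ᶠ ρ in 𝓝[>] (0 : ℝ), g.label (Φ (ρ, 0)) = g.label (Φ (-f.ret ρ, 0)) := by
  have hV : {p | p ∈ U ∧ 2 * polarRadius (Φ p) < g.radius} ∈ 𝓝 (0 : ℝ × ℝ) := by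
    have h1 : ContinuousAt (fun p => 2 * polarRadius (Φ p)) 0 :=
      continuousAt_const.mul
        (continuous_polarRadius.continuousAt.comp (hc.continuousAt hU))
    exact inter_mem hU (h1.eventually (gt_mem_nhds (by
      simpa [h0, polarRadius_zero] using g.radius_pos)))
  filter_upwards [f.eventually_small, f.eventually_arc_mem hV] with ρ hρ harc
  have hρ' : |ρ| < f.radius := by rw [abs_of_pos hρ.1]; exact hρ.2
  rw [← f.arc_zero hρ', ← f.arc_pi]
  refine g.label_eq_of_curve (η := fun θ => Φ (f.arc ρ θ)) Real.pi_pos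
    (hc.comp (f.continuousOn_arc hρ') fun θ _ => (harc θ).1)
    (fun θ _ => hne _ (harc θ).1 (f.arc_ne_zero hρ.1 hρ.2 θ)) (fun θ _ => (harc θ).2)
    fun θ hθ => ?_
  have hpos : f.arc ρ θ ∈ U ∩ upperSide := ⟨(harc θ).1, f.arc_snd_pos hρ.1 hρ.2 hθ⟩
  obtain ⟨L, k, hL, hk⟩ := hdir _ hpos
  refine ⟨hup _ hpos, (f.speed θ (f.radial ρ θ))⁻¹ * k, ?_⟩
  have := hL.comp_hasDerivAt θ (f.hasDerivAt_arc hρ' hθ)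
  rwa [map_smul, hk, smul_smul] at this

/-- Suppose that `reflectX` interchanges, up to time reversal, the images of `F` under `ψ` and
of `G` under `φ`. Then `φ⁻¹ ∘ reflectX ∘ ψ` carries the ends of half-orbits of `F` to the ends
of half-orbits of `G`. -/
theorem eventually_label_reflect {G F' G' : ℝ × ℝ → ℝ × ℝ} (g : PolarFlow G)
    {ψ φ : OpenPartialHomeomorph (ℝ × ℝ) (ℝ × ℝ)} (hψ : IsSideMap ψ) (hφ : IsSideMap φ)
    (hψF : TransformsField ψ upperSide F F') (hφG : TransformsField φ upperSide G G')
    (hrev : ∀ᶠ q in 𝓝 (0 : ℝ × ℝ), q ∈ upperSide → G' (reflectX q) = -reflectX (F' q)) :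
    ∀ᶠ ρ in 𝓝[>] (0 : ℝ), g.label (φ.symm (reflectX (ψ (ρ, 0)))) =
      g.label (φ.symm (reflectX (ψ (-f.ret ρ, 0)))) := by
  have ht : Tendsto (fun p => reflectX (ψ p)) (𝓝 0) (𝓝 0) := by
    have := (reflectX.continuous.tendsto 0).comp hψ.tendsto
    rwa [map_zero] at this
  have hinj : ∀ q, reflectX q = 0 → q = 0 := fun q hq => by
    rw [reflectX_apply, Prod.mk_eq_zero, neg_eq_zero] at hq
    exact Prod.ext hq.1 hq.2
  obtain ⟨U, hU, hUmem⟩ : ∃ U ∈ 𝓝 (0 : ℝ × ℝ), ∀ p ∈ U,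
      (p ∈ ψ.source ∧ reflectX (ψ p) ∈ φ.target) ∧
      (ψ p ∈ upperSide → G' (reflectX (ψ p)) = -reflectX (F' (ψ p))) :=
    ⟨_, inter_mem (inter_mem hψ.source_mem_nhds (ht (hφ.symm.source_mem_nhds)))
      (hψ.tendsto.eventually hrev), fun p hp => hp⟩
  have hup : ∀ p ∈ U ∩ upperSide, reflectX (ψ p) ∈ upperSide := fun p hp =>
    (hψ.side p (hUmem p hp.1).1.1).2 hp.2
  have hup' : ∀ p ∈ U ∩ upperSide, φ.symm (reflectX (ψ p)) ∈ upperSide := fun p hp =>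
    (hφ.symm.side _ (hUmem p hp.1).1.2).2 (hup p hp)
  have hc : ContinuousOn (fun p => reflectX (ψ p)) U :=
    reflectX.continuous.comp_continuousOn (ψ.continuousOn.mono fun p hp => (hUmem p hp).1.1)
  have hc' : ContinuousOn (fun p => φ.symm (reflectX (ψ p))) U :=
    ContinuousOn.comp (g := φ.symm) (f := fun p => reflectX (ψ p)) φ.continuousOn_symm hc
      fun p hp => (hUmem p hp).1.2
  have h0 : φ.symm (reflectX (ψ 0)) = 0 := by rw [hψ.map_zero, map_zero, hφ.symm_zero]
  have hne : ∀ p ∈ U, p ≠ 0 → φ.symm (reflectX (ψ p)) ≠ 0 := fun p hp h0 =>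
    hφ.symm.ne_zero (hUmem p hp).1.2 fun h => hψ.ne_zero (hUmem p hp).1.1 h0 (hinj _ h)
  refine f.eventually_label_eq g (Φ := fun p => φ.symm (reflectX (ψ p))) hU hc' h0 hne hup' ?_
  intro p hp
  have h1 := hψF.carriesDirection ⟨(hUmem p hp.1).1.1, hp.2⟩
  have h2 : CarriesDirection reflectX F' G' (ψ p) :=
      ⟨reflectX, -1, reflectX.hasFDerivAt, by
        rw [(hUmem p hp.1).2 ((hψ.side p (hUmem p hp.1).1.1).2 hp.2), neg_one_smul, neg_neg]⟩
  have h3 : CarriesDirection (fun p => reflectX (ψ p)) F G' p := h2.comp h1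
  have h4 := hφG.carriesDirection_symm (hUmem p hp.1).1.2 (hup' p hp)
  exact CarriesDirection.comp (Φ := fun p => reflectX (ψ p)) h4 h3

end PolarFlow

theorem eventually_axis {P : ℝ × ℝ → Prop} (h : ∀ᶠ p in 𝓝 (0 : ℝ × ℝ), P p) :
    ∀ᶠ x in 𝓝 (0 : ℝ), P (x, 0) := by
  have hc : ContinuousAt (fun x : ℝ => (x, (0 : ℝ))) 0 := by fun_prop
  exact hc.eventually h

/-- If the image of the field under `ψ` is invariant under `(x, y, t) ↦ (-x, y, -t)`, then `ψ`
carries the two ends of a half-orbit to points symmetric to each other. -/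
theorem PolarFlow.eventually_apply_ret_of_reversible {F F' : ℝ × ℝ → ℝ × ℝ} (f : PolarFlow F)
    {ψ : OpenPartialHomeomorph (ℝ × ℝ) (ℝ × ℝ)} (hψ : IsSideMap ψ)
    (hψF : TransformsField ψ upperSide F F')
    (hrev : ∀ᶠ q in 𝓝 (0 : ℝ × ℝ), q ∈ upperSide → F' (reflectX q) = -reflectX (F' q)) :
    ∀ᶠ ρ in 𝓝[>] (0 : ℝ), ψ (-f.ret ρ, 0) = -ψ (ρ, 0) := by
  have hlabel := f.eventually_label_reflect f hψ hψ hψF hψF hrev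
  -- `ψ₀` is the restriction of `ψ` to the line, and `s` the involution `x ↦ -x` in the coordinate
  -- `ψ₀`
  set ψ₀ : ℝ → ℝ := fun x => (ψ (x, 0)).1 with hψ₀
  set s : ℝ → ℝ := fun x => (ψ.symm (reflectX (ψ (x, 0)))).1 with hs
  have hsrc : ∀ᶠ x in 𝓝 (0 : ℝ), (x, (0 : ℝ)) ∈ ψ.source := eventually_axis hψ.source_mem_nhds
  have hψx : ∀ x, (x, (0 : ℝ)) ∈ ψ.source → ψ (x, 0) = (ψ₀ x, 0) := fun x hx =>
    Prod.ext rfl (hψ.snd_eq_zero hx)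
  have ht : Tendsto (fun p => reflectX (ψ p)) (𝓝 0) (𝓝 0) := by
    have := (reflectX.continuous.tendsto 0).comp hψ.tendsto
    rwa [map_zero] at this
  have htgt : ∀ᶠ x in 𝓝 (0 : ℝ), reflectX (ψ (x, 0)) ∈ ψ.target :=
    eventually_axis (ht.eventually hψ.symm.source_mem_nhds)
  have hs0 : Tendsto s (𝓝 0) (𝓝 0) := by
    have h1 : Tendsto (fun x : ℝ => ψ.symm (reflectX (ψ (x, 0)))) (𝓝 0) (𝓝 0) :=
      (hψ.symm.tendsto.comp ht).comp
        (show Tendsto (fun x : ℝ => (x, (0 : ℝ))) (𝓝 0) (𝓝 0) from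
          (by fun_prop : Continuous fun x : ℝ => (x, (0 : ℝ))).tendsto 0)
    exact (continuous_fst.tendsto (0 : ℝ × ℝ)).comp h1
  have hspt : ∀ᶠ x in 𝓝 (0 : ℝ), ψ.symm (reflectX (ψ (x, 0))) = (s x, 0) := by
    filter_upwards [hsrc, htgt] with x h1 h2
    refine Prod.ext rfl ?_
    have h3 : reflectX (ψ (x, 0)) = (-ψ₀ x, 0) := by rw [hψx x h1, reflectX_apply]
    rw [h3] at h2 ⊢
    exact hψ.symm.snd_eq_zero h2
  have hψs : ∀ᶠ x in 𝓝 (0 : ℝ), ψ₀ (s x) = -ψ₀ x := by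
    filter_upwards [hspt, htgt] with x h1 h2
    rw [hψ₀]
    dsimp only
    rw [← h1, ψ.right_inv h2, reflectX_apply]
  have hss : ∀ᶠ x in 𝓝 (0 : ℝ), s (s x) = x := by
    filter_upwards [hspt, htgt, hsrc] with x h1 h2 h3
    have h4 : ψ (s x, 0) = reflectX (ψ (x, 0)) := by rw [← h1, ψ.right_inv h2]
    rw [hs]
    dsimp only
    rw [h4, reflectX_apply, reflectX_apply, neg_neg, Prod.mk.eta, ψ.left_inv h3]
  -- on a small interval the restriction of `ψ` to the line is strictly monotone or antitone
  obtain ⟨ε, hε, hεsrc⟩ := Metric.nhds_basis_closedBall.eventually_iff.1 hsrc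
  simp only [Real.closedBall_eq_Icc, zero_sub, zero_add] at hεsrc
  have hψc : ContinuousOn ψ₀ (Icc (-ε) ε) :=
    continuous_fst.comp_continuousOn (ψ.continuousOn.comp (by fun_prop) fun x hx => hεsrc hx)
  have hψi : InjOn ψ₀ (Icc (-ε) ε) := fun x hx y hy hxy => by
    have h1 : ψ (x, 0) = ψ (y, 0) := by
      rw [hψx x (hεsrc hx), hψx y (hεsrc hy), hxy]
    exact (Prod.mk.inj (ψ.injOn (hεsrc hx) (hεsrc hy) h1)).1
  have hmono := hψc.strictMonoOn_of_injOn_Icc' (by linarith) hψi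
  set D := {x | (x ∈ Icc (-ε) ε ∧ s x ∈ Icc (-ε) ε) ∧ ψ₀ (s x) = -ψ₀ x}
  have hI : Icc (-ε) ε ∈ 𝓝 (0 : ℝ) := Icc_mem_nhds (by linarith) hε
  have hD : D ∈ 𝓝 (0 : ℝ) := inter_mem (inter_mem hI (hs0 hI)) hψs
  have hanti : StrictAntiOn s D := fun x hx y hy hxy => by
    rcases hmono with h | h
    · rw [← h.lt_iff_lt hy.1.2 hx.1.2, hx.2, hy.2, neg_lt_neg_iff]
      exact h hx.1.1 hy.1.1 hxy
    · rw [← h.lt_iff_gt hx.1.2 hy.1.2, hx.2, hy.2, neg_lt_neg_iff]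
      exact h hx.1.1 hy.1.1 hxy
  have hsz : s 0 = 0 := by
    have : ψ.symm (reflectX (ψ 0)) = 0 := by rw [hψ.map_zero, map_zero, hψ.symm_zero]
    exact congrArg Prod.fst this
  have hgood : ∀ᶠ x in 𝓝 (0 : ℝ), (x ∈ D ∧ s x ∈ D) ∧ s (s x) = x ∧
      ψ.symm (reflectX (ψ (x, 0))) = (s x, 0) ∧ 2 * |s x| < f.radius ∧
      (x, (0 : ℝ)) ∈ ψ.source ∧ (s x, (0 : ℝ)) ∈ ψ.source := by
    have h1 : ∀ᶠ x in 𝓝 (0 : ℝ), 2 * |s x| < f.radius := by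
      have : Tendsto (fun x => 2 * |s x|) (𝓝 0) (𝓝 0) := by
        simpa using hs0.abs.const_mul 2
      exact this.eventually (gt_mem_nhds f.radius_pos)
    filter_upwards [hD, hs0 hD, hss, hspt, h1, hsrc, hs0.eventually hsrc] with
      x a1 a2 a3 a4 a5 a6 a7 using ⟨⟨a1, a2⟩, a3, a4, a5, a6, a7⟩
  have hgood₁ : ∀ᶠ ρ in 𝓝[>] (0 : ℝ), _ := nhdsWithin_le_nhds hgood
  have hneg : Tendsto (fun ρ => -f.ret ρ) (𝓝[>] 0) (𝓝 0) := by
    simpa using (f.tendsto_ret.mono_right nhdsWithin_le_nhds).neg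
  filter_upwards [hlabel, hgood₁, hneg.eventually hgood, f.eventually_small] with
    ρ hlab hρ hσ hsmall
  obtain ⟨⟨hρD, hsρD⟩, hssρ, hptρ, hbρ, hsrcρ, hsrcsρ⟩ := hρ
  obtain ⟨⟨hσD, hsσD⟩, hssσ, hptσ, hbσ, -, -⟩ := hσ
  rw [hptρ, hptσ] at hlab
  have h0D : (0 : ℝ) ∈ D := mem_of_mem_nhds hD
  set q := s (-f.ret ρ) with hq
  have hσpos := f.ret_pos hsmall.1 hsmall.2
  have hsρneg : s ρ < 0 := hsz ▸ hanti h0D hρD hsmall.1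
  have hqpos : 0 < q := hsz ▸ hanti hσD h0D (neg_lt_zero.2 hσpos)
  rw [abs_of_neg hsρneg] at hbρ
  rw [abs_of_pos hqpos] at hbσ
  rw [f.label_pos_axis hqpos (by linarith)] at hlab
  have hPq : f.ret q = -s ρ := by
    have := f.label_neg_axis (x := -s ρ) (by linarith) hbρ
    rwa [neg_neg, hlab] at this
  -- `s` and `-ret` are decreasing and `s ρ = -ret q`, `s q = -ret ρ`, which forces `q = ρ`
  have hretmono : StrictMonoOn f.ret (Ioo (-f.radius) f.radius) := f.radial_strictMono Real.pi
  have hqm : q ∈ Ioo (-f.radius) f.radius := ⟨by linarith, by linarith⟩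
  have hρm : ρ ∈ Ioo (-f.radius) f.radius := ⟨by linarith, hsmall.2⟩
  have hqρ : q = ρ := by
    rcases lt_trichotomy q ρ with h | h | h
    · have h1 := hanti hsσD hρD h
      have h2 := hretmono hqm hρm h
      rw [hssσ] at h1
      linarith
    · exact h
    · have h1 := hanti hρD hsσD h
      have h2 := hretmono hρm hqm h
      rw [hssσ] at h1
      linarith
  rw [hqρ] at hPq
  have h1 : (-f.ret ρ, (0 : ℝ)) = (s ρ, 0) := by rw [hPq, neg_neg]
  rw [h1, hψx _ hsrcsρ, hρD.2, hψx ρ hsrcρ, Prod.neg_mk, neg_zero]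

/-! ### First integrals, and the three conditions -/

theorem neg_mem_lowerSide (p : ℝ × ℝ) : -p ∈ lowerSide ↔ p ∈ upperSide := by
  simp [lowerSide, upperSide]

/-- A function that is constant along the solutions of `G` is constant along their
reparametrizations. -/
theorem eq_of_reparametrized_solution {G : ℝ × ℝ → ℝ × ℝ} {W : Set (ℝ × ℝ)} {H : ℝ × ℝ → ℝ}
    (hH : ∀ (γ : ℝ → ℝ × ℝ) (a b : ℝ),
      (∀ t ∈ Ioo a b, γ t ∈ W ∧ HasDerivAt γ (G (γ t)) t) →
      ∀ s ∈ Ioo a b, ∀ t ∈ Ioo a b, H (γ s) = H (γ t))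
    {ζ : ℝ → ℝ × ℝ} {k : ℝ → ℝ} {a b : ℝ} (hk : ContinuousOn k (Ioo a b))
    (hpos : ∀ t ∈ Ioo a b, 0 < k t)
    (hζ : ∀ t ∈ Ioo a b, ζ t ∈ W ∧ HasDerivAt ζ (k t • G (ζ t)) t) :
    ∀ s ∈ Ioo a b, ∀ t ∈ Ioo a b, H (ζ s) = H (ζ t) := by
  intro s hs t ht
  wlog hst : s ≤ t generalizing s t
  · exact (this t ht s hs (le_of_not_ge hst)).symm
  obtain ⟨s', hs'a, hs's⟩ := exists_between hs.1
  obtain ⟨t', htt', ht'b⟩ := exists_between ht.2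
  have hle : s' ≤ t' := (hs's.le.trans hst).trans htt'.le
  have hsub : Icc s' t' ⊆ Ioo a b := fun x hx => ⟨hs'a.trans_le hx.1, hx.2.trans_lt ht'b⟩
  have hk' := hk.mono hsub
  set κ : ℝ → ℝ := IccExtend hle ((Icc s' t').domRestrict k) with hκ
  have hκc : Continuous κ := hk'.domRestrict.Icc_extend'
  have hκk : EqOn κ k (Icc s' t') := fun x hx => IccExtend_of_mem hle _ hx
  obtain ⟨x, hx, hxmin⟩ := isCompact_Icc.exists_isMinOn (nonempty_Icc.2 hle) hk'
  obtain ⟨e, he⟩ := exists_orderIso_of_integral (κ := κ) (hpos x (hsub hx))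
    (fun y => hxmin (projIcc s' t' hle y).2) fun a b => hκc.intervalIntegrable a b
  have h := hH (fun y => ζ (e.symm y)) (e s') (e t') (fun y hy => ?_)
    (e s) ⟨e.lt_iff_lt.2 hs's, e.lt_iff_lt.2 (hst.trans_lt htt')⟩
    (e t) ⟨e.lt_iff_lt.2 (hs's.trans_le hst), e.lt_iff_lt.2 htt'⟩
  · simpa using h
  · obtain ⟨z, rfl⟩ := e.surjective y
    have hz : z ∈ Icc s' t' := ⟨(e.lt_iff_lt.1 hy.1).le, (e.lt_iff_lt.1 hy.2).le⟩
    rw [e.symm_apply_apply]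
    refine ⟨(hζ z (hsub hz)).1, (hasDerivWithinAt_comp_symm hle he hk'
      (hκk.mono Ioo_subset_Icc_self) (fun θ hθ => hpos θ (hsub hθ))
      (fun θ hθ => (hζ θ (hsub hθ)).2.hasDerivWithinAt) hz).hasDerivAt (Icc_mem_nhds hy.1 hy.2)⟩

namespace PolarFlow

variable {F F' : ℝ × ℝ → ℝ × ℝ} {ψ : OpenPartialHomeomorph (ℝ × ℝ) (ℝ × ℝ)}
  {H : ℝ × ℝ → ℝ}

/-- A first integral of the transformed field, pulled back, is constant on the closed
half-orbits. -/
theorem eventually_firstIntegral_arc (f : PolarFlow F) (hψ : IsSideMap ψ)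
    (hψF : TransformsField ψ upperSide F F') (hH : IsFirstIntegralNear F' upperSide H) :
    ∀ᶠ ρ in 𝓝[>] (0 : ℝ), ∀ θ ∈ Icc 0 Real.pi, H (ψ (f.arc ρ θ)) = H (ψ (ρ, 0)) := by
  obtain ⟨⟨U, hU, hUc, hUH⟩, -⟩ := hH
  obtain ⟨c, hc, hcF⟩ := hψF
  filter_upwards [f.eventually_small,
    f.eventually_arc_mem (inter_mem hψ.source_mem_nhds (hψ.tendsto hU))] with ρ hρ harc
  have hρ' : |ρ| < f.radius := by rw [abs_of_pos hρ.1]; exact hρ.2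
  have hup : ∀ θ ∈ Ioo 0 Real.pi, f.arc ρ θ ∈ ψ.source ∩ upperSide := fun θ hθ =>
    ⟨(harc θ).1, f.arc_snd_pos hρ.1 hρ.2 hθ⟩
  have hnonneg : ∀ θ ∈ Icc 0 Real.pi, 0 ≤ (f.arc ρ θ).2 := fun θ hθ =>
    mul_nonneg (f.radial_pos hρ.1 hρ.2 θ).le (Real.sin_nonneg_of_mem_Icc hθ)
  have hcarc := f.continuousOn_arc hρ'
  have hcont : ContinuousOn (fun θ => H (ψ (f.arc ρ θ))) (Icc 0 Real.pi) := by
    have h1 : ContinuousOn (fun θ => ψ (f.arc ρ θ)) (Icc 0 Real.pi) :=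
      ContinuousOn.comp (g := ψ) ψ.continuousOn hcarc fun θ _ => (harc θ).1
    refine ContinuousOn.comp (g := H) hUc h1 fun θ hθ => ⟨(harc θ).2, ?_⟩
    rw [closure_upperSide]
    exact hψ.snd_nonneg (harc θ).1 (hnonneg θ hθ)
  have hconst := eq_of_reparametrized_solution (ζ := fun θ => ψ (f.arc ρ θ))
    (k := fun θ => (f.speed θ (f.radial ρ θ))⁻¹ * (c (f.arc ρ θ))⁻¹) hUH
    (a := 0) (b := Real.pi) ?_ ?_ ?_
  · have hmid : Real.pi / 2 ∈ Ioo 0 Real.pi :=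
      ⟨Real.pi_div_two_pos, half_lt_self Real.pi_pos⟩
    have heq : EqOn (fun θ => H (ψ (f.arc ρ θ))) (fun _ => H (ψ (f.arc ρ (Real.pi / 2))))
        (Icc 0 Real.pi) :=
      EqOn.of_subset_closure (s := Ioo 0 Real.pi) (fun θ hθ => hconst θ hθ _ hmid) hcont
        continuousOn_const Ioo_subset_Icc_self (closure_Ioo Real.pi_pos.ne).ge
    intro θ hθ
    have h0 := heq (left_mem_Icc.2 Real.pi_pos.le)
    dsimp only at h0
    rw [f.arc_zero hρ'] at h0
    exact (heq hθ).trans h0.symm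
  · refine (((f.continuousOn_speed hρ').mono Ioo_subset_Icc_self).inv₀ fun θ hθ =>
      (f.speed_radial_pos hρ' (Ioo_subset_Icc_self hθ)).ne').mul
      (ContinuousOn.inv₀ (ContinuousOn.comp (g := c) hc (hcarc.mono Ioo_subset_Icc_self)
        hup) fun θ hθ => (hcF _ (hup θ hθ)).1.ne')
  · exact fun θ hθ => mul_pos (inv_pos.2 (f.speed_radial_pos hρ' (Ioo_subset_Icc_self hθ)))
      (inv_pos.2 (hcF _ (hup θ hθ)).1)
  · intro θ hθ
    refine ⟨⟨(harc θ).2, (hψ.side _ (harc θ).1).2 (hup θ hθ).2⟩, ?_⟩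
    obtain ⟨hcpos, L, hL, hLF⟩ := hcF _ (hup θ hθ)
    have := hL.comp_hasDerivAt θ (f.hasDerivAt_arc hρ' hθ)
    refine this.congr_deriv ?_
    rw [hLF, mul_smul, inv_smul_smul₀ hcpos.ne', map_smul]
    rfl

/-- A first integral cannot be constant on the positive half-axis, since every nearby half-orbit
starts there. -/
theorem not_eventually_firstIntegral_const (f : PolarFlow F) (hψ : IsSideMap ψ)
    (hψF : TransformsField ψ upperSide F F') (hH : IsFirstIntegralNear F' upperSide H) (c₀ : ℝ) :
    ¬∀ᶠ ρ in 𝓝[>] (0 : ℝ), H (ψ (ρ, 0)) = c₀ := by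
  intro hc₀
  obtain ⟨ε, hε, hεsub⟩ := mem_nhdsGT_iff_exists_Ioo_subset.1
    (hc₀.and (f.eventually_firstIntegral_arc hψ hψF hH))
  rw [mem_Ioi] at hε
  have hV : {p : ℝ × ℝ | 2 * polarRadius p < min ε f.radius} ∈ 𝓝 (0 : ℝ × ℝ) := by
    have hc : ContinuousAt (fun p => 2 * polarRadius p) 0 :=
      (continuous_const.mul continuous_polarRadius).continuousAt
    exact hc.eventually (gt_mem_nhds (by simpa [polarRadius_zero] using ⟨hε, f.radius_pos⟩))
  have hconst : ∀ p : ℝ × ℝ, 2 * polarRadius p < min ε f.radius → p ∈ upperSide →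
      H (ψ p) = c₀ := by
    intro p hp hup
    have h0 : p ≠ 0 := by
      rintro rfl
      exact lt_irrefl (0 : ℝ) hup
    have hp1 := hp.trans_le (min_le_left _ _)
    have hp2 := hp.trans_le (min_le_right _ _)
    obtain ⟨⟨h1, -⟩, -⟩ := f.label_spec h0 hp2
    obtain ⟨h3, h4⟩ := hεsub ⟨h1, (f.label_le h0 hp2).trans_lt hp1⟩
    have := h4 _ (polarAngle_mem p)
    rwa [f.arc_label h0 (le_of_lt hup) hp2, h3] at this
  obtain ⟨p, hp, q, hq, hpq⟩ := hH.2 _ (inter_mem hψ.symm.source_mem_nhds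
    (hψ.symm.tendsto hV))
  have key : ∀ p ∈ (ψ.symm.source ∩ ψ.symm ⁻¹' {p | 2 * polarRadius p < min ε f.radius}) ∩
      upperSide, H p = c₀ := fun p hp => by
    have := hconst (ψ.symm p) hp.1.2 ((hψ.symm.side p hp.1.1).2 hp.2)
    rwa [ψ.right_inv hp.1.1] at this
  exact hpq ((key p hp).trans (key q hq).symm)

end PolarFlow

/-- An analytic germ `φ` at the right of its fixed point `0` is the identity or has no other fixed
points nearby; in the second case every invariant continuous function is constant, because the
smallest point of a level set would otherwise be moved to a smaller one by `φ` or by its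
inverse. -/
theorem eventually_fixed_or_invariant_const {φ h : ℝ → ℝ} (hφ : AnalyticAt ℝ φ 0) (hφ0 : φ 0 = 0)
    (hpos : ∀ᶠ x in 𝓝[>] (0 : ℝ), 0 < φ x)
    (hh : ∀ᶠ x in 𝓝[≥] (0 : ℝ), ContinuousWithinAt h (Ici 0) x)
    (hinv : ∀ᶠ x in 𝓝[>] (0 : ℝ), h (φ x) = h x) :
    (∀ᶠ x in 𝓝[>] (0 : ℝ), φ x = x) ∨ ∀ᶠ x in 𝓝[>] (0 : ℝ), h x = h 0 := by
  rcases (hφ.sub analyticAt_id).eventually_eq_zero_or_eventually_ne_zero with hz | hz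
  · left
    filter_upwards [nhdsWithin_le_nhds hz] with x hx using sub_eq_zero.1 hx
  right
  have hne : ∀ᶠ x in 𝓝[>] (0 : ℝ), φ x ≠ x := by
    filter_upwards [nhdsGT_le_nhdsNE 0 hz] with x hx using sub_ne_zero.1 hx
  have hcφ : ∀ᶠ x in 𝓝[≥] (0 : ℝ), ContinuousAt φ x :=
    nhdsWithin_le_nhds (hφ.eventually_analyticAt.mono fun _ h => h.continuousAt)
  obtain ⟨ε₁, hε₁, h1⟩ := mem_nhdsGT_iff_exists_Ioo_subset.1 (hne.and (hpos.and hinv))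
  obtain ⟨ε₂, hε₂, h2⟩ := mem_nhdsGE_iff_exists_Ico_subset.1 (hh.and hcφ)
  rw [mem_Ioi] at hε₁ hε₂
  filter_upwards [Ioo_mem_nhdsGT (lt_min hε₁ hε₂)] with ρ hρ
  have hρ1 := hρ.2.trans_le (min_le_left _ _)
  have hρ2 := hρ.2.trans_le (min_le_right _ _)
  have hsub : ∀ x ∈ Icc 0 ρ, x ∈ Ico 0 ε₂ := fun x hx => ⟨hx.1, hx.2.trans_lt hρ2⟩
  have hhc : ContinuousOn h (Icc 0 ρ) := fun x hx =>
    (h2 (hsub x hx)).1.mono Icc_subset_Ici_self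
  have hcomp : IsCompact (Icc 0 ρ ∩ h ⁻¹' {h ρ}) :=
    isCompact_Icc.of_isClosed_subset (hhc.preimage_isClosed_of_isClosed isClosed_Icc
      isClosed_singleton) inter_subset_left
  obtain ⟨x, ⟨hx, hxρ⟩, hmin⟩ := hcomp.exists_isLeast ⟨ρ, ⟨hρ.1.le, le_rfl⟩, rfl⟩
  rw [mem_preimage, mem_singleton_iff] at hxρ
  rcases hx.1.eq_or_lt with h0 | h0
  · rw [h0, hxρ]
  exfalso
  obtain ⟨hx1, hx2, hx3⟩ := h1 ⟨h0, hx.2.trans_lt hρ1⟩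
  rcases lt_or_gt_of_ne hx1 with hlt | hgt
  · exact hlt.not_ge (hmin ⟨⟨hx2.le, hlt.le.trans hx.2⟩, hx3.trans hxρ⟩)
  · have hφc : ContinuousOn φ (Icc 0 x) := fun y hy =>
      (h2 (hsub y ⟨hy.1, hy.2.trans hx.2⟩)).2.continuousWithinAt
    obtain ⟨y, hy, hyx⟩ := intermediate_value_Icc h0.le hφc
      (show x ∈ Icc (φ 0) (φ x) from ⟨hφ0.trans_le h0.le, hgt.le⟩)
    have hy0 : 0 < y := lt_of_le_of_ne hy.1 fun h => by
      rw [← h, hφ0] at hyx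
      exact h0.ne hyx
    have hyx' : y < x := lt_of_le_of_ne hy.2 fun h => by
      rw [h] at hyx
      exact hx1 hyx
    obtain ⟨-, -, hy3⟩ := h1 ⟨hy0, hyx'.trans (hx.2.trans_lt hρ1)⟩
    rw [hyx] at hy3
    exact hyx'.not_ge (hmin ⟨⟨hy.1, hyx'.le.trans hx.2⟩, hy3.symm.trans hxρ⟩)

/-- The local homeomorphism `p ↦ -ψ (-p)`, which turns a statement about the lower side into one
about the upper side. -/
def rotateHomeomorph (ψ : OpenPartialHomeomorph (ℝ × ℝ) (ℝ × ℝ)) :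
    OpenPartialHomeomorph (ℝ × ℝ) (ℝ × ℝ) :=
  ((Homeomorph.neg (ℝ × ℝ)).transOpenPartialHomeomorph ψ).transHomeomorph (Homeomorph.neg (ℝ × ℝ))

theorem rotateHomeomorph_apply (ψ : OpenPartialHomeomorph (ℝ × ℝ) (ℝ × ℝ)) (p : ℝ × ℝ) :
    rotateHomeomorph ψ p = -ψ (-p) := rfl

theorem mem_rotateHomeomorph_source {ψ : OpenPartialHomeomorph (ℝ × ℝ) (ℝ × ℝ)} {p : ℝ × ℝ} :
    p ∈ (rotateHomeomorph ψ).source ↔ -p ∈ ψ.source := Iff.rfl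

theorem TwinTransformation.isSideMap_upper (Ψ : TwinTransformation) : IsSideMap Ψ.upper :=
  ⟨Ψ.zero_mem_upper, Ψ.upper_zero, Ψ.upper_side⟩

theorem TwinTransformation.isSideMap_lower (Ψ : TwinTransformation) :
    IsSideMap (rotateHomeomorph Ψ.lower) where
  zero_mem := by
    rw [mem_rotateHomeomorph_source, neg_zero]
    exact Ψ.zero_mem_lower
  map_zero := by rw [rotateHomeomorph_apply, neg_zero, Ψ.lower_zero, neg_zero]
  side p hp := by
    rw [← neg_mem_lowerSide, ← neg_mem_lowerSide, rotateHomeomorph_apply, neg_neg]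
    exact Ψ.lower_side _ hp

theorem TransformsField.rotate {ψ : OpenPartialHomeomorph (ℝ × ℝ) (ℝ × ℝ)} {F G : ℝ × ℝ → ℝ × ℝ}
    (h : TransformsField ψ lowerSide F G) :
    TransformsField (rotateHomeomorph ψ) upperSide (rotateField F) (rotateField G) := by
  obtain ⟨c, hc, h⟩ := h
  have hm : ∀ p ∈ (rotateHomeomorph ψ).source ∩ upperSide, -p ∈ ψ.source ∩ lowerSide :=
    fun p hp => ⟨hp.1, (neg_mem_lowerSide p).2 hp.2⟩
  refine ⟨fun p => c (-p), ContinuousOn.comp (g := c) hc continuous_neg.continuousOn hm,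
    fun p hp => ?_⟩
  obtain ⟨hcp, L, hL, hG⟩ := h (-p) (hm p hp)
  refine ⟨hcp, L, ?_, ?_⟩
  · have h1 := (hL.comp p (hasFDerivAt_id p).neg).neg
    refine h1.congr_fderiv ?_
    ext <;> simp
  · rw [rotateHomeomorph_apply, rotateField, rotateField, neg_neg, hG, map_neg, smul_neg]

theorem closure_lowerSide_neg {p : ℝ × ℝ} (hp : p ∈ closure upperSide) :
    -p ∈ closure lowerSide :=
  map_mem_closure continuous_neg hp fun q hq => (neg_mem_lowerSide q).2 hq

theorem neg_preimage_mem_nhds {U : Set (ℝ × ℝ)} (hU : U ∈ 𝓝 0) :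
    (fun p : ℝ × ℝ => -p) ⁻¹' U ∈ 𝓝 0 := by
  refine (continuous_neg.tendsto (0 : ℝ × ℝ)) ?_
  rwa [neg_zero]

theorem IsFirstIntegralNear.rotate {F : ℝ × ℝ → ℝ × ℝ} {H : ℝ × ℝ → ℝ}
    (h : IsFirstIntegralNear F lowerSide H) :
    IsFirstIntegralNear (rotateField F) upperSide fun p => H (-p) := by
  obtain ⟨⟨U, hU, hc, hH⟩, hne⟩ := h
  refine ⟨⟨_, neg_preimage_mem_nhds hU, ?_, ?_⟩, ?_⟩
  · exact ContinuousOn.comp (g := H) hc continuous_neg.continuousOn fun p hp =>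
      ⟨hp.1, closure_lowerSide_neg hp.2⟩
  · intro γ a b hγ s hs t ht
    refine hH (fun x => -γ x) a b (fun x hx => ?_) s hs t ht
    obtain ⟨h1, h2⟩ := hγ x hx
    refine ⟨⟨h1.1, (neg_mem_lowerSide _).2 h1.2⟩, h2.neg.congr_deriv ?_⟩
    rw [rotateField, neg_neg]
  · intro V hV
    obtain ⟨p, hp, q, hq, hpq⟩ := hne _ (neg_preimage_mem_nhds hV)
    refine ⟨-p, ⟨hp.1, ?_⟩, -q, ⟨hq.1, ?_⟩, by simpa using hpq⟩
    · rw [← neg_mem_lowerSide, neg_neg]; exact hp.2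
    · rw [← neg_mem_lowerSide, neg_neg]; exact hq.2

section Center

variable {Z W : PiecewiseField} {Ψ : TwinTransformation} (f : PolarFlow Z.upper)
  (g : PolarFlow (rotateField Z.lower))

theorem TwinTransformation.eventually_agree (Ψ : TwinTransformation) :
    ∀ᶠ x in 𝓝 (0 : ℝ), (x, (0 : ℝ)) ∈ Ψ.upper.source ∧ (x, (0 : ℝ)) ∈ Ψ.lower.source ∧
      Ψ.upper (x, 0) = Ψ.lower (x, 0) := by
  have h := eventually_axis (inter_mem (Ψ.upper.open_source.mem_nhds Ψ.zero_mem_upper)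
    (Ψ.lower.open_source.mem_nhds Ψ.zero_mem_lower))
  filter_upwards [h] with x hx using ⟨hx.1, hx.2, Ψ.agree x hx.1 hx.2⟩

theorem PolarFlow.tendsto_neg_ret {F : ℝ × ℝ → ℝ × ℝ} (f : PolarFlow F) :
    Tendsto (fun ρ => -f.ret ρ) (𝓝[>] 0) (𝓝 0) := by
  simpa using (f.tendsto_ret.mono_right nhdsWithin_le_nhds).neg

include f g

/-- The reflection across the line carries the image of an upper half-orbit to an orbit of `W` below
the line with the same ends, and `Ψ⁻` carries it back to an orbit of `Z` with the ends of the upper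
half-orbit. -/
theorem isCenter_of_isReversibleAcross (hΨ : Ψ.Transforms Z W) (h : W.IsReversibleAcross) :
    Z.IsCenter := by
  refine f.isCenter_of_ret_ret g ?_
  have hrev : ∀ᶠ q in 𝓝 (0 : ℝ × ℝ), q ∈ upperSide →
      rotateField W.lower (reflectX q) = -reflectX (W.upper q) := by
    have ht : Tendsto (fun q : ℝ × ℝ => -reflectX q) (𝓝 0) (𝓝 0) := by
      simpa using (reflectX.continuous.tendsto 0).neg
    filter_upwards [ht.eventually h] with q hq hup
    have := hq (by simpa [reflectX_apply] using (show 0 < q.2 from hup))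
    rw [rotateField, this]
    simp [reflectX_apply]
  have hlabel := f.eventually_label_reflect g Ψ.isSideMap_upper Ψ.isSideMap_lower hΨ.1
    hΨ.2.rotate hrev
  have haxis : ∀ᶠ x in 𝓝 (0 : ℝ),
      (rotateHomeomorph Ψ.lower).symm (reflectX (Ψ.upper (x, 0))) = (-x, 0) := by
    filter_upwards [Ψ.eventually_agree] with x ⟨h1, h2, h3⟩
    have h4 := Ψ.isSideMap_upper.snd_eq_zero h1
    have h5 : reflectX (Ψ.upper (x, 0)) = rotateHomeomorph Ψ.lower (-x, 0) := by
      have h6 : -((-x, 0) : ℝ × ℝ) = (x, 0) := by simp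
      rw [rotateHomeomorph_apply, h6, ← h3, reflectX_apply]
      exact Prod.ext rfl (by simp [h4])
    rw [h5, (rotateHomeomorph Ψ.lower).left_inv]
    rw [mem_rotateHomeomorph_source]
    simpa using h2
  filter_upwards [hlabel, nhdsWithin_le_nhds haxis, f.tendsto_neg_ret.eventually haxis,
    f.eventually_small, f.tendsto_ret.eventually g.eventually_small,
    Ioo_mem_nhdsGT (show 0 < g.radius / 2 by linarith [g.radius_pos])] with ρ h1 h2 h3 h4 h5 h6
  rw [h2, h3, neg_neg, g.label_pos_axis h5.1 h5.2] at h1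
  rw [← h1]
  exact g.label_neg_axis h4.1 (by linarith [h6.2])

/-- If both sides of `W` are reversible, the images under `Ψ` of the two ends of a half-orbit are
symmetric to each other, on both sides of the line, so that the two half-return maps are inverse to
each other. -/
theorem isCenter_of_isReversibleOnSides (hΨ : Ψ.Transforms Z W) (h : W.IsReversibleOnSides) :
    Z.IsCenter := by
  refine f.isCenter_of_ret_ret g ?_
  have ht : Tendsto (fun q : ℝ × ℝ => reflectX q) (𝓝 0) (𝓝 0) := by
    simpa using reflectX.continuous.tendsto 0
  have hrev₁ : ∀ᶠ q in 𝓝 (0 : ℝ × ℝ), q ∈ upperSide →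
      W.upper (reflectX q) = -reflectX (W.upper q) := by
    filter_upwards [ht.eventually h] with q hq hup
    have := hq.1 (by simpa [reflectX_apply] using (show 0 < q.2 from hup))
    rw [this]
    simp [reflectX_apply]
  have hrev₂ : ∀ᶠ q in 𝓝 (0 : ℝ × ℝ), q ∈ upperSide →
      rotateField W.lower (reflectX q) = -reflectX (rotateField W.lower q) := by
    have ht' : Tendsto (fun q : ℝ × ℝ => -reflectX q) (𝓝 0) (𝓝 0) := by
      simpa using (reflectX.continuous.tendsto 0).neg
    filter_upwards [ht'.eventually h] with q hq hup
    have := hq.2 (by simpa [reflectX_apply] using (show 0 < q.2 from hup))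
    rw [rotateField, this, rotateField]
    simp only [reflectX_apply, Prod.neg_mk, neg_neg, Prod.fst_neg, Prod.snd_neg]
    rfl
  have hup := f.eventually_apply_ret_of_reversible Ψ.isSideMap_upper hΨ.1 hrev₁
  have hlo := f.tendsto_ret.eventually
    (g.eventually_apply_ret_of_reversible Ψ.isSideMap_lower hΨ.2.rotate hrev₂)
  have hgf : Tendsto (fun ρ => g.ret (f.ret ρ)) (𝓝[>] 0) (𝓝 0) :=
    (g.tendsto_ret.comp f.tendsto_ret).mono_right nhdsWithin_le_nhds
  filter_upwards [hup, hlo, nhdsWithin_le_nhds Ψ.eventually_agree,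
    f.tendsto_neg_ret.eventually Ψ.eventually_agree, hgf.eventually Ψ.eventually_agree] with
    ρ h1 h2 h3 h4 h5
  simp only [rotateHomeomorph_apply, Prod.neg_mk, neg_neg, neg_zero] at h2
  rw [← h4.2.2, h1, h3.2.2, neg_inj] at h2
  exact (Prod.mk.inj (Ψ.lower.injOn h5.2.1 h3.2.1 h2)).1

/-- The common restriction of the two first integrals to the line is invariant under the
analytic return map; it is not constant, so that the return map is the identity. -/
theorem isCenter_of_hasMatchingFirstIntegrals (hΨ : Ψ.Transforms Z W)
    (h : W.HasMatchingFirstIntegrals) : Z.IsCenter := by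
  refine f.isCenter_of_ret_ret g ?_
  obtain ⟨H₁, H₂, hH₁, hH₂, hmatch⟩ := h
  have hup := f.eventually_firstIntegral_arc Ψ.isSideMap_upper hΨ.1 hH₁
  have hlo := g.eventually_firstIntegral_arc Ψ.isSideMap_lower hΨ.2.rotate hH₂.rotate
  have hmatch' : ∀ᶠ x in 𝓝 (0 : ℝ), H₁ (Ψ.upper (x, 0)) = H₂ (Ψ.lower (x, 0)) := by
    have ht : Tendsto (fun p => (Ψ.upper p).1) (𝓝 0) (𝓝 0) :=
      (continuous_fst.tendsto (0 : ℝ × ℝ)).comp Ψ.isSideMap_upper.tendsto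
    filter_upwards [Ψ.eventually_agree, eventually_axis (ht.eventually hmatch)] with x hx hm
    have hx0 : Ψ.upper (x, 0) = ((Ψ.upper (x, 0)).1, 0) :=
      Prod.ext rfl (Ψ.isSideMap_upper.snd_eq_zero hx.1)
    rw [← hx.2.2, hx0, hm]
  have hgf : Tendsto (fun ρ => g.ret (f.ret ρ)) (𝓝[>] 0) (𝓝[>] 0) :=
    g.tendsto_ret.comp f.tendsto_ret
  have hf0 : f.ret 0 = 0 := f.radial_zero _
  have hg0 : g.ret 0 = 0 := g.radial_zero _
  refine (eventually_fixed_or_invariant_const (φ := fun ρ => g.ret (f.ret ρ))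
    (h := fun x => H₁ (Ψ.upper (x, 0))) ?_ ?_ ?_ ?_ ?_).resolve_right
      (f.not_eventually_firstIntegral_const Ψ.isSideMap_upper hΨ.1 hH₁ _)
  · refine AnalyticAt.fun_comp (g := g.ret) ?_ f.analytic_return
    rw [hf0]
    exact g.analytic_return
  · rw [hf0, hg0]
  · exact hgf.eventually self_mem_nhdsWithin
  · obtain ⟨⟨U, hU, hUc, -⟩, -⟩ := hH₁
    have hUsrc : ∀ᶠ p in 𝓝 (0 : ℝ × ℝ), p ∈ Ψ.upper.source ∧ Ψ.upper p ∈ interior U :=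
      inter_mem Ψ.isSideMap_upper.source_mem_nhds
        (Ψ.isSideMap_upper.tendsto (interior_mem_nhds.2 hU))
    filter_upwards [nhdsWithin_le_nhds (eventually_axis hUsrc.eventually_nhds)] with x hx
    have hx' := hx.self_of_nhds
    have hc : ContinuousAt (fun y : ℝ => Ψ.upper (y, 0)) x :=
      ContinuousAt.comp (g := Ψ.upper) (Ψ.upper.continuousAt hx'.1) (by fun_prop)
    have hnear : ∀ᶠ y in 𝓝 x, (y, (0 : ℝ)) ∈ Ψ.upper.source ∧ Ψ.upper (y, 0) ∈ interior U :=
      (by fun_prop : ContinuousAt (fun y : ℝ => (y, (0 : ℝ))) x).eventually hx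
    have hcl : ∀ y : ℝ, (y, (0 : ℝ)) ∈ Ψ.upper.source → Ψ.upper (y, 0) ∈ closure upperSide :=
      fun y hy => by
      rw [closure_upperSide]
      exact Ψ.isSideMap_upper.snd_nonneg hy le_rfl
    have h1 : ContinuousWithinAt H₁ (U ∩ closure upperSide) (Ψ.upper (x, 0)) :=
      hUc _ ⟨interior_subset hx'.2, hcl x hx'.1⟩
    refine (h1.tendsto.comp (tendsto_nhdsWithin_iff.2 ⟨hc.tendsto, ?_⟩)).mono_left
      nhdsWithin_le_nhds
    filter_upwards [hnear] with y hy using ⟨interior_subset hy.2, hcl y hy.1⟩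
  · filter_upwards [hup, f.tendsto_ret.eventually hlo, nhdsWithin_le_nhds hmatch',
      f.tendsto_neg_ret.eventually hmatch',
      (hgf.mono_right nhdsWithin_le_nhds).eventually hmatch'] with ρ h1 h2 h3 h4 h5
    have h6 := h1 _ (right_mem_Icc.2 Real.pi_pos.le)
    have h7 := h2 _ (right_mem_Icc.2 Real.pi_pos.le)
    rw [f.arc_pi] at h6
    rw [g.arc_pi] at h7
    simp only [rotateHomeomorph_apply, Prod.neg_mk, neg_neg, neg_zero] at h7
    rw [h5, h7, ← h4, h6]

end Center

theorem theorem6 (Z W : PiecewiseField) (hZ : Z.IsCanonical)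
    (Ψ : TwinTransformation) (hΨ : Ψ.Transforms Z W)
    (h : W.HasMatchingFirstIntegrals ∨ W.IsReversibleAcross ∨ W.IsReversibleOnSides) :
    Z.IsCenter := by
  obtain ⟨f⟩ := hZ.1.nonempty_polarFlow
  obtain ⟨g⟩ := hZ.2.rotate.nonempty_polarFlow
  rcases h with h | h | h
  · exact isCenter_of_hasMatchingFirstIntegrals f g hΨ h
  · exact isCenter_of_isReversibleAcross f g hΨ h
  · exact isCenter_of_isReversibleOnSides f g hΨ h
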